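/- **Graphs.** Write $[N]=\{1,\dots,N\}$. A directed graph $G$ on a finite node set $V$ is $(e,d)$-depth-robust if for every $S\subseteq V$ with $|S|\le e$ the graph $G-S$ contains a directed path of length $d$ (i.e. with $d$ edges and $d+1$ distinct nodes). A DAG $G$ is $\varepsilon$-extreme depth-robust if it is $(e,d)$-depth-robust for all integers $e,d\ge 0$ with $e+d\le(1-\varepsilon)|V|$. **Bipartite expanders.** For $m\ge1$ let $\sigma_0,\dots,\sigma_4$ be the permutations of $\{0,\dots,m-1\}^2$ given by $\sigma_0(x,y)=(x,y)$, $\sigma_1(x,y)=(x,x+y)$, $\sigma_2(x,y)=(x,x+y+1)$, $\sigma_3(x,y)=(x+y,y)$, $\sigma_4(x,y)=(x+y+1,y)$ (addition modulo $m$). Transport them to permutations $\sigma'_k$ of $[m^2]$ by the bijection $(x,y)\mapsto xm+y+1$. Put $\Gamma^1_m(j)=\{\sigma'_0(j),\dots,\sigma'_4(j)\}$ and $\Gamma^{i+1}_m(j)=\bigcup_{j'\in\Gamma^1_m(j)}\Gamma^i_m(j')$. For $0<\delta<1/2$ let $L_\delta=\left\lceil\frac{\log((1-\delta)/\delta)}{\log(1+c\delta)}\right\rceil+1$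 with $c=(2-\sqrt3)/4$, let $m(N)$ be the least positive integer $m$ with $m^2\ge N$, and let $$B(N,\delta,j)=[N]\cap\Gamma_{m(N)}^{L_{\delta/2}}(j).$$ **The graph $G(\delta,N)$, $N=2^n$.** Its node set is $[N]$, and the parents of $v\in[N]$ are the nodes $u\in[N]$ with $u\neq v$ such that $v-4n\le u\le v-1$ or $$u=\left(\left\lfloor v/2^t\right\rfloor-i\right)2^t+y$$ for some integers $t,i,y$ with $1\le t\le\lceil\log_2 v\rceil$, $1\le i\le\min\{\lfloor v/2^t\rfloor,10\}$ and $y\in B\left(2^t,\delta/5,(v\bmod 2^t)+1\right)$. **Theorem.** Let $\varepsilon>0$. There is a unique real number $\delta_\varepsilon$ with $$\frac{1+2.1\,\delta_\varepsilon}{1-2.1\,\delta_\varepsilon}=1+\min\{\varepsilon,1/3\},$$ and the graphs $G(\delta_\varepsilon,N=2^n)$ have the following properties. 1. For every integer $n\ge1$, the graph $G(\delta_\varepsilon,2^n)$ is a DAG and is $\varepsilon$-extreme depth-robust. 2. The maximum indegree of $G(\delta_\varepsilon,N)$ is $O(\log N)$: there is a constant $C=C(\varepsilon)$ such that it is at most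 $Cn$ for every $n\ge1$. 3. The family is explicit and locally navigable: there is a single algorithm (depending on $\varepsilon$) which, on input $v\in[N]$ and $N=2^n$, $n\ge1$, lists the parents of $v$ in $G(\delta_\varepsilon,N)$ in time at most $C'(\log_2 N)^{k}=C'n^k$, with constants $C',k$ depending only on $\varepsilon$. (Algorithms are register programs over the natural numbers with assignment of constants, $+$, truncated $-$, $\times$, integer division, remainder, output, branching and while-loops. An arithmetic operation is charged the square of one plus the total bit length of its operands; every other step is charged one plus the bit length of the number it handles.) -/

import Mathlib

namespace ExtremeDR

/-! ### Directed graphs, paths, depth-robustness -/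

section Graphs

variable {V : Type*} [Fintype V] [DecidableEq V]

/-- `G` has no directed cycle (in particular no self-loop). -/
def IsAcyclic (G : Digraph V) : Prop :=
  ∀ v, ¬ Relation.TransGen G.Adj v v

/-- `G - S` contains a directed path `p 0, p 1, …, p d` of length `d`
(that is, with `d` edges and `d + 1` distinct nodes, all outside `S`). -/
def HasPathAvoiding (G : Digraph V) (S : Finset V) (d : ℕ) : Prop :=
  ∃ p : Fin (d + 1) → V, Function.Injective p ∧
    (∀ i : Fin d, G.Adj (p i.castSucc) (p i.succ)) ∧ ∀ i, p i ∉ S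

/-- `(e, d)`-depth-robustness: deleting any at most `e` nodes leaves a directed path of
length `d`. -/
def DepthRobust (G : Digraph V) (e d : ℕ) : Prop :=
  ∀ S : Finset V, S.card ≤ e → HasPathAvoiding G S d

/-- `G` is an `ε`-extreme depth-robust DAG. -/
def ExtremeDepthRobust (ε : ℝ) (G : Digraph V) : Prop :=
  IsAcyclic G ∧
    ∀ e d : ℕ, (e : ℝ) + (d : ℝ) ≤ (1 - ε) * (Fintype.card V : ℝ) → DepthRobust G e d

open Classical in
/-- The set of parents of a node. -/
noncomputable def parents (G : Digraph V) (v : V) : Finset V :=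
  Finset.univ.filter fun u => G.Adj u v

/-- The maximum indegree. -/
noncomputable def indeg (G : Digraph V) : ℕ :=
  Finset.univ.sup fun v => (parents G v).card

end Graphs

/-- The node set `[N] = {1, …, N}`. -/
abbrev Node (N : ℕ) : Type := {v : ℕ // v ∈ Finset.Icc 1 N}

/-! ### The Gabber–Galil expander on `{1, …, m²}` -/

/-- The five permutations of `{0, …, m-1}²`. -/
def ggPerm (m : ℕ) : Fin 5 → ℕ × ℕ → ℕ × ℕ
  | 0, (x, y) => (x, y)
  | 1, (x, y) => (x, (x + y) % m)
  | 2, (x, y) => (x, (x + y + 1) % m)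
  | 3, (x, y) => ((x + y) % m, y)
  | 4, (x, y) => ((x + y + 1) % m, y)

def pairToInt (m : ℕ) (p : ℕ × ℕ) : ℕ := p.1 * m + p.2 + 1

def intToPair (m z : ℕ) : ℕ × ℕ := ((z - 1) / m, (z - 1) % m)

def getParentsGG (m j : ℕ) : Finset ℕ :=
  Finset.univ.image fun k : Fin 5 => pairToInt m (ggPerm m k (intToPair m j))

/-- The `i`-fold layering; `getParentsLayered 1 m = getParentsGG m`. -/
def getParentsLayered : ℕ → ℕ → ℕ → Finset ℕ
  | 0, _, j => {j}
  | i + 1, m, j => (getParentsGG m j).biUnion fun j' => getParentsLayered i m j'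

/-! ### Bipartite expanders `H_{N,δ}` -/

/-- The expansion constant `d = (2 - √3) / 4`. -/
noncomputable def ggConst : ℝ := (2 - Real.sqrt 3) / 4

/-- The number of layers `L_δ = ⌈log ((1 - δ) / δ) / log (1 + d δ)⌉ + 1`. -/
noncomputable def numLayers (δ : ℝ) : ℕ :=
  ⌈Real.log ((1 - δ) / δ) / Real.log (1 + ggConst * δ)⌉₊ + 1

/-- The least positive `m` with `N ≤ m²`. -/
noncomputable def sideLen (N : ℕ) : ℕ := sInf {m : ℕ | 0 < m ∧ N ≤ m ^ 2}

/-- The set of `i` such that `(a_i, b_j)` is an edge of `H_{N,δ}`. -/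
noncomputable def getParentsBE (N : ℕ) (δ : ℝ) (j : ℕ) : Finset ℕ :=
  Finset.Icc 1 N ∩ getParentsLayered (numLayers (δ / 2)) (sideLen N) j

/-! ### The graph `G(δ, N)`, `N = 2 ^ n` -/

/-- `GetParentsEGS(δ, v, 2 ^ n)`. Where `v < 4 n` the lower end `v - 4 * n` is truncated to `0`,
which the final intersection with `{1, …, N}` makes harmless. -/
noncomputable def getParentsEGS (δ : ℝ) (n v : ℕ) : Finset ℕ :=
  (Finset.Ico (v - 4 * n) v ∪
    (Finset.Icc 1 (Nat.clog 2 v)).biUnion fun t =>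
      (getParentsBE (2 ^ t) (δ / 5) (v % 2 ^ t + 1)).biUnion fun y =>
        (Finset.Icc 1 (min (v / 2 ^ t) 10)).image fun i => (v / 2 ^ t - i) * 2 ^ t + y) ∩
  Finset.Icc 1 (2 ^ n)

/-- The graph `G(δ, 2 ^ n)` on `{1, …, 2 ^ n}`, with self-loops left out. -/
noncomputable def egsGraph (δ : ℝ) (n : ℕ) : Digraph (Node (2 ^ n)) where
  Adj u v := (u : ℕ) ∈ getParentsEGS δ n v ∧ u ≠ v

/-- `δ` satisfies the defining equation of `δ_ε`, with `ε` replaced by `1/3` when `ε > 1/3`. -/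
def IsDelta (ε δ : ℝ) : Prop :=
  (1 + 2.1 * δ) / (1 - 2.1 * δ) = 1 + min ε (1 / 3)

/-! ### Algorithms with a running time

Register programs over the natural numbers. Time is measured in bit operations: an arithmetic
operation is charged quadratically in the bit lengths of its operands (as for schoolbook
arithmetic), so numbers of unbounded size give no free computing power. -/

inductive Op
  | add | sub | mul | div | mod

/-- Natural-number operations (`sub` truncated at `0`). -/
def Op.eval : Op → ℕ → ℕ → ℕ
  | .add, a, b => a + b
  | .sub, a, b => a - b
  | .mul, a, b => a * b
  | .div, a, b => a / b
  | .mod, a, b => a % b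

inductive Prog
  /-- register `x` := the constant `c` -/
  | const (x c : ℕ)
  /-- register `x` := register `y` `o` register `z` -/
  | op (o : Op) (x y z : ℕ)
  /-- append register `x` to the output -/
  | emit (x : ℕ)
  | seq (p q : Prog)
  /-- if register `x` is nonzero then `p` else `q` -/
  | ite (x : ℕ) (p q : Prog)
  /-- while register `x` is nonzero do `p` -/
  | while (x : ℕ) (p : Prog)

/-- `Exec p s s' out t`: started with register contents `s`, program `p` halts with register
contents `s'` after time `t`, having output the list `out`. -/
inductive Exec : Prog → (ℕ → ℕ) → (ℕ → ℕ) → List ℕ → ℕ → Prop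
  | const (x c : ℕ) (s : ℕ → ℕ) :
      Exec (.const x c) s (Function.update s x c) [] (1 + c.size)
  | op (o : Op) (x y z : ℕ) (s : ℕ → ℕ) :
      Exec (.op o x y z) s (Function.update s x (o.eval (s y) (s z))) []
        ((1 + (s y).size + (s z).size) ^ 2)
  | emit (x : ℕ) (s : ℕ → ℕ) : Exec (.emit x) s s [s x] (1 + (s x).size)
  | seq {p q : Prog} {s s' s'' : ℕ → ℕ} {out out' : List ℕ} {t t' : ℕ} :
      Exec p s s' out t → Exec q s' s'' out' t' →
        Exec (.seq p q) s s'' (out ++ out') (t + t')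
  | ite_pos {x : ℕ} {p q : Prog} {s s' : ℕ → ℕ} {out : List ℕ} {t : ℕ} :
      s x ≠ 0 → Exec p s s' out t → Exec (.ite x p q) s s' out (1 + (s x).size + t)
  | ite_neg {x : ℕ} {p q : Prog} {s s' : ℕ → ℕ} {out : List ℕ} {t : ℕ} :
      s x = 0 → Exec q s s' out t → Exec (.ite x p q) s s' out (1 + (s x).size + t)
  | while_done {x : ℕ} {p : Prog} {s : ℕ → ℕ} :
      s x = 0 → Exec (.while x p) s s [] (1 + (s x).size)
  | while_step {x : ℕ} {p : Prog} {s s' s'' : ℕ → ℕ} {out out' : List ℕ} {t t' : ℕ} :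
      s x ≠ 0 → Exec p s s' out t → Exec (.while x p) s' s'' out' t' →
        Exec (.while x p) s s'' (out ++ out') (1 + (s x).size + t + t')

/-- The initial registers on input `(v, N)`: `v` in register `0`, `N` in register `1`, and `0`
elsewhere. -/
def input (v N : ℕ) : ℕ → ℕ := fun i => if i = 0 then v else if i = 1 then N else 0

/-- A family of graphs on `[2 ^ n]` is (explicit and) locally navigable: one program, given `v` and
`N = 2 ^ n`, lists the parents of `v` in time polynomial in `log N`. -/
def LocallyNavigable (G : ∀ n : ℕ, Digraph (Node (2 ^ n))) : Prop :=
  ∃ (P : Prog) (C k : ℕ), ∀ n : ℕ, 1 ≤ n → ∀ v : Node (2 ^ n),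
    ∃ (s : ℕ → ℕ) (out : List ℕ) (t : ℕ),
      Exec P (input v (2 ^ n)) s out t ∧
      (∀ u : ℕ, u ∈ out ↔ ∃ h : u ∈ Finset.Icc 1 (2 ^ n), (G n).Adj ⟨u, h⟩ v) ∧
      t ≤ C * n ^ k

end ExtremeDR

/-! The graph is a local expander: in any window of `2 r + 1` consecutive nodes, two sets of at
least `δ r` nodes, one before the other, are joined by an edge (`isLocalExpander_edge`).
Depth-robustness is a combinatorial consequence. Fix `γ = 2.1 δ ≥ 2 δ` and call an undeleted node
good if every interval starting or ending at it keeps at least a `γ`-fraction of undeleted nodes. A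
bad node starts or ends an interval that is mostly deleted; a greedy cover by such intervals leaves
at least `N - (1 + γ) / (1 - γ) |S|` good nodes (`le_card_good`). From a good node most undeleted
nodes of every following interval are reachable, by doubling the interval, and the mirror statement
holds to the left. Hence any two good nodes are connected (`transGen_of_good`), and one path runs
through all of them. The equation for `δ_ε` makes the factor `1 + min ε (1/3)`, which is what `e + d
≤ (1 - ε) N` affords.

Local expansion reduces, by pigeonhole on dyadic blocks, to the bipartite expanders between blocks
of size `2 ^ t` (`exists_mem_getParentsBE`). These rest on a spectral gap on `(ZMod m)²`
(`spectral_gap`). The Fourier transform turns shears into shears of the frequency and translations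
into phases. Frequencies far from `0` are controlled by translations. Each nonzero frequency near
`0` has two outward shears, and all these images are distinct, so the mass near `0` cannot be nearly
shear-invariant. The resulting vertex expansion multiplies the odds `|X| / (m² - |X|)` by `1 + 1/64`
per layer, and `numLayers` layers carry the odds from `d / (1 - d)` beyond `(1 - d) / d`.

For navigation, the number of layers depends on `δ` only, so the expander walks unroll into a fixed
loop-free program. A single loop over the `n` dyadic levels remains; its registers return to a known
state of `O(n)` bits after each round, which gives cubic time. -/

namespace ExtremeDR

open Finset ComplexConjugate

/-! ### Fourier analysis of shears and translations on `(ZMod m)²` -/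

section Fourier

variable {m : ℕ} [NeZero m]

lemma conj_stdAddChar (x : ZMod m) :
    conj (ZMod.stdAddChar x : ℂ) = ZMod.stdAddChar (-x) := by
  rw [AddChar.map_neg_eq_inv, ZMod.stdAddChar_apply, ← Circle.coe_inv_eq_conj, Circle.coe_inv]

lemma norm_stdAddChar (x : ZMod m) : ‖(ZMod.stdAddChar x : ℂ)‖ = 1 := by
  rw [ZMod.stdAddChar_apply]; exact Circle.norm_coe _

/-- Parseval's identity on `ZMod m`. -/
lemma sum_norm_sq_dft (f : ZMod m → ℂ) :
    ∑ a, ‖∑ x, f x * ZMod.stdAddChar (a * x)‖ ^ 2 = m * ∑ x, ‖f x‖ ^ 2 := by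
  have key : ∀ x y : ZMod m, ∑ a : ZMod m, (ZMod.stdAddChar (a * x) : ℂ) *
      conj (ZMod.stdAddChar (a * y) : ℂ) = if x = y then (m : ℂ) else 0 := by
    intro x y
    have := AddChar.sum_mulShift (x - y) (ZMod.isPrimitive_stdAddChar m)
    simp only [sub_eq_zero, ZMod.card] at this
    rw [show (if x = y then (m : ℂ) else 0) = ((if x = y then m else 0 : ℕ) : ℂ) by
      split_ifs <;> simp, ← this]
    refine sum_congr rfl fun a _ => ?_
    rw [conj_stdAddChar, ← AddChar.map_add_eq_mul]
    congr 1; ring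
  have h : ((∑ a, ‖∑ x, f x * ZMod.stdAddChar (a * x)‖ ^ 2 : ℝ) : ℂ)
      = ((m * ∑ x, ‖f x‖ ^ 2 : ℝ) : ℂ) := by
    push_cast
    simp_rw [← Complex.mul_conj', map_sum, sum_mul_sum, map_mul]
    rw [sum_comm, mul_sum]
    refine sum_congr rfl fun x _ => ?_
    rw [sum_comm]
    calc _ = ∑ y, f x * conj (f y) * ∑ a : ZMod m, (ZMod.stdAddChar (a * x) : ℂ) *
              conj (ZMod.stdAddChar (a * y) : ℂ) := by
          refine sum_congr rfl fun y _ => ?_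
          rw [mul_sum]
          exact sum_congr rfl fun a _ => by ring
      _ = _ := by
          simp_rw [key]
          simp [mul_comm]
  exact_mod_cast h

/-- The unnormalised Fourier transform on `(ZMod m)²`. -/
noncomputable def dft₂ (f : ZMod m × ZMod m → ℂ) (c : ZMod m × ZMod m) : ℂ :=
  ∑ x, (∑ y, f (x, y) * ZMod.stdAddChar (c.2 * y)) * ZMod.stdAddChar (c.1 * x)

lemma dft₂_eq (f : ZMod m × ZMod m → ℂ) (c : ZMod m × ZMod m) :
    dft₂ f c = ∑ z : ZMod m × ZMod m, f z * ZMod.stdAddChar (c.1 * z.1 + c.2 * z.2) := by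
  rw [dft₂, Fintype.sum_prod_type]
  refine sum_congr rfl fun x _ => ?_
  rw [sum_mul]
  refine sum_congr rfl fun y _ => ?_
  rw [AddChar.map_add_eq_mul]; ring

/-- Parseval's identity on `(ZMod m)²`. -/
lemma sum_norm_sq_dft₂ (f : ZMod m × ZMod m → ℂ) :
    ∑ c, ‖dft₂ f c‖ ^ 2 = (m : ℝ) ^ 2 * ∑ z, ‖f z‖ ^ 2 := by
  simp_rw [dft₂]
  rw [Fintype.sum_prod_type, sum_comm]
  simp_rw [sum_norm_sq_dft, ← mul_sum]
  rw [sum_comm]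
  simp_rw [sum_norm_sq_dft, ← mul_sum]
  rw [Fintype.sum_prod_type]; ring

lemma dft₂_zero (f : ZMod m × ZMod m → ℂ) : dft₂ f 0 = ∑ z, f z := by
  simp [dft₂_eq]

lemma dft₂_sub (f g : ZMod m × ZMod m → ℂ) (c : ZMod m × ZMod m) :
    dft₂ (fun z => f z - g z) c = dft₂ f c - dft₂ g c := by
  simp [dft₂_eq, sub_mul, sum_sub_distrib]

/-- The shears and unit translations of `(ZMod m)²`. -/
def shearY : ZMod m × ZMod m ≃ ZMod m × ZMod m where
  toFun z := (z.1, z.1 + z.2)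
  invFun z := (z.1, z.2 - z.1)
  left_inv z := by simp
  right_inv z := by simp

def shearX : ZMod m × ZMod m ≃ ZMod m × ZMod m where
  toFun z := (z.1 + z.2, z.2)
  invFun z := (z.1 - z.2, z.2)
  left_inv z := by simp
  right_inv z := by simp

def transY : ZMod m × ZMod m ≃ ZMod m × ZMod m where
  toFun z := (z.1, z.2 + 1)
  invFun z := (z.1, z.2 - 1)
  left_inv z := by simp
  right_inv z := by simp

def transX : ZMod m × ZMod m ≃ ZMod m × ZMod m where
  toFun z := (z.1 + 1, z.2)
  invFun z := (z.1 - 1, z.2)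
  left_inv z := by simp
  right_inv z := by simp

/-- The horizontal shear is the transpose of the vertical one, so precomposing with one acts on
frequencies by the other. -/
lemma dft₂_shearY (f : ZMod m × ZMod m → ℂ) (c : ZMod m × ZMod m) :
    dft₂ (fun z => f (shearY z)) (shearX c) = dft₂ f c := by
  rw [dft₂_eq, dft₂_eq, ← shearY.sum_comp (fun z => f z * _)]
  refine sum_congr rfl fun z _ => ?_
  simp only [shearX, shearY, Equiv.coe_fn_mk]
  congr 2; ring

lemma dft₂_shearX (f : ZMod m × ZMod m → ℂ) (c : ZMod m × ZMod m) :
    dft₂ (fun z => f (shearX z)) (shearY c) = dft₂ f c := by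
  rw [dft₂_eq, dft₂_eq, ← shearX.sum_comp (fun z => f z * _)]
  refine sum_congr rfl fun z _ => ?_
  simp only [shearX, shearY, Equiv.coe_fn_mk]
  congr 2; ring

/-- A translation only changes phases in frequency space. -/
lemma dft₂_transY (f : ZMod m × ZMod m → ℂ) (c : ZMod m × ZMod m) :
    dft₂ f c = ZMod.stdAddChar c.2 * dft₂ (fun z => f (transY z)) c := by
  rw [dft₂_eq, dft₂_eq, ← transY.sum_comp (fun z => f z * _), mul_sum]
  refine sum_congr rfl fun z _ => ?_
  simp only [transY, Equiv.coe_fn_mk]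
  rw [mul_left_comm, ← AddChar.map_add_eq_mul]
  congr 2; ring

lemma dft₂_transX (f : ZMod m × ZMod m → ℂ) (c : ZMod m × ZMod m) :
    dft₂ f c = ZMod.stdAddChar c.1 * dft₂ (fun z => f (transX z)) c := by
  rw [dft₂_eq, dft₂_eq, ← transX.sum_comp (fun z => f z * _), mul_sum]
  refine sum_congr rfl fun z _ => ?_
  simp only [transX, Equiv.coe_fn_mk]
  rw [mul_left_comm, ← AddChar.map_add_eq_mul]
  congr 2; ring

/-- The energy of `f` along the permutation `σ`. -/
noncomputable def energy (f : ZMod m × ZMod m → ℂ) (σ : ZMod m × ZMod m ≃ ZMod m × ZMod m) : ℝ :=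
  ∑ z, ‖f (σ z) - f z‖ ^ 2

/-- By Parseval and the reverse triangle inequality, only the moduli of the Fourier coefficients are
needed from here on. This makes the remaining problem one about a real function on frequencies. -/
lemma sum_norm_shearX_le (f : ZMod m × ZMod m → ℂ) :
    ∑ c, (‖dft₂ f (shearX c)‖ - ‖dft₂ f c‖) ^ 2 ≤ (m : ℝ) ^ 2 * energy f shearY := by
  rw [energy, ← sum_norm_sq_dft₂, ← shearX.sum_comp (fun c => ‖dft₂ _ c‖ ^ 2)]
  refine sum_le_sum fun c _ => ?_
  rw [dft₂_sub, dft₂_shearY, ← sq_abs, abs_sub_comm]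
  gcongr
  exact abs_norm_sub_norm_le _ _

lemma sum_norm_shearY_le (f : ZMod m × ZMod m → ℂ) :
    ∑ c, (‖dft₂ f (shearY c)‖ - ‖dft₂ f c‖) ^ 2 ≤ (m : ℝ) ^ 2 * energy f shearX := by
  rw [energy, ← sum_norm_sq_dft₂, ← shearY.sum_comp (fun c => ‖dft₂ _ c‖ ^ 2)]
  refine sum_le_sum fun c _ => ?_
  rw [dft₂_sub, dft₂_shearX, ← sq_abs, abs_sub_comm]
  gcongr
  exact abs_norm_sub_norm_le _ _

/-- The value is `exp (i θ)` with `|θ|` between `π / 2` and `π`, so `cos θ ≤ 0`, and `|exp (i θ) -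
1|² = 2 - 2 cos θ`. -/
lemma two_le_norm_stdAddChar_sub_one {x : ZMod m} (hx : (m : ℤ) ≤ 4 * |x.valMinAbs|) :
    2 ≤ ‖(ZMod.stdAddChar x : ℂ) - 1‖ ^ 2 := by
  have hm : (0 : ℝ) < m := by exact_mod_cast Nat.pos_of_ne_zero (NeZero.ne m)
  have h2 := ZMod.valMinAbs_mem_Ioc x
  set j : ℤ := x.valMinAbs with hj
  have hxj : x = (j : ZMod m) := (ZMod.coe_valMinAbs x).symm
  set θ : ℝ := 2 * Real.pi * (|j| : ℤ) / m with hθ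
  have hcos : Real.cos θ ≤ 0 := by
    apply Real.cos_nonpos_of_pi_div_two_le_of_le
    · rw [hθ, le_div_iff₀ hm]
      have : (m : ℝ) ≤ 4 * (|j| : ℤ) := by exact_mod_cast hx
      nlinarith [Real.pi_pos]
    · rw [hθ, div_le_iff₀ hm]
      have : |j| * 2 ≤ (m : ℤ) := by
        rcases abs_cases j with h | h <;> have := h2.1 <;> have := h2.2 <;> omega
      have : ((|j| : ℤ) : ℝ) * 2 ≤ m := by exact_mod_cast this
      nlinarith [Real.pi_pos]
  have hre : (ZMod.stdAddChar x : ℂ).re = Real.cos θ := by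
    have h1 : (2 * Real.pi * Complex.I * j / m : ℂ)
        = ((2 * Real.pi * j / m : ℝ) : ℂ) * Complex.I := by
      push_cast; ring
    rw [hxj, ZMod.stdAddChar_coe, h1, Complex.exp_ofReal_mul_I_re, hθ]
    rcases abs_cases j with h | h
    · rw [h.1]
    · rw [h.1, ← Real.cos_neg]; congr 1; push_cast; ring
  have hn : ‖(ZMod.stdAddChar x : ℂ) - 1‖ ^ 2 = 2 - 2 * Real.cos θ := by
    have h1 : (ZMod.stdAddChar x : ℂ).re * (ZMod.stdAddChar x : ℂ).re
        + (ZMod.stdAddChar x : ℂ).im * (ZMod.stdAddChar x : ℂ).im = 1 := by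
      have := norm_stdAddChar x
      rw [← Complex.normSq_apply, ← Complex.sq_norm, this]; norm_num
    rw [Complex.sq_norm, Complex.normSq_apply, ← hre]
    simp only [Complex.sub_re, Complex.sub_im, Complex.one_re, Complex.one_im, sub_zero]
    nlinarith
  rw [hn]; linarith

lemma sum_trans_le (f : ZMod m × ZMod m → ℂ) :
    ∑ c : ZMod m × ZMod m, (‖(ZMod.stdAddChar c.1 : ℂ) - 1‖ ^ 2
      + ‖(ZMod.stdAddChar c.2 : ℂ) - 1‖ ^ 2) * ‖dft₂ f c‖ ^ 2
      = (m : ℝ) ^ 2 * (energy f transX + energy f transY) := by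
  rw [energy, energy, mul_add, ← sum_norm_sq_dft₂, ← sum_norm_sq_dft₂, ← sum_add_distrib]
  have aux : ∀ (w a b : ℂ), ‖w‖ = 1 → b = w * a → ‖w - 1‖ ^ 2 * ‖b‖ ^ 2 = ‖a - b‖ ^ 2 := by
    intro w a b hw hb
    rw [hb, norm_mul, hw, one_mul, ← mul_pow, ← norm_mul, ← norm_neg]
    congr 2; ring
  refine sum_congr rfl fun c _ => ?_
  rw [dft₂_sub, dft₂_sub, add_mul, aux _ _ _ (norm_stdAddChar _) (dft₂_transX f c),
    aux _ _ _ (norm_stdAddChar _) (dft₂_transY f c)]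

end Fourier

/-! ### Outward shears of low frequencies and the spectral gap -/

section Quadrants

lemma prod_ext_valMinAbs {m : ℕ} {z w : ZMod m × ZMod m} (h1 : z.1.valMinAbs = w.1.valMinAbs)
    (h2 : z.2.valMinAbs = w.2.valMinAbs) : z = w :=
  Prod.ext (ZMod.injective_valMinAbs h1) (ZMod.injective_valMinAbs h2)

variable {m : ℕ} [NeZero m]

/-- Two representatives below `m / 4` add up to less than `m / 2`, so nothing wraps around and
shears of the box can be computed in `ℤ²`. -/
lemma valMinAbs_add_of_small {x y : ZMod m} (hx : 4 * |x.valMinAbs| < m)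
    (hy : 4 * |y.valMinAbs| < m) : (x + y).valMinAbs = x.valMinAbs + y.valMinAbs := by
  rw [ZMod.valMinAbs_spec]
  refine ⟨by push_cast [ZMod.coe_valMinAbs]; rfl, ?_⟩
  rw [abs_eq_max_neg] at hx hy
  constructor <;> omega

lemma valMinAbs_sub_of_small {x y : ZMod m} (hx : 4 * |x.valMinAbs| < m)
    (hy : 4 * |y.valMinAbs| < m) : (x - y).valMinAbs = x.valMinAbs - y.valMinAbs := by
  rw [ZMod.valMinAbs_spec]
  refine ⟨by push_cast [ZMod.coe_valMinAbs]; rfl, ?_⟩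
  rw [abs_eq_max_neg] at hx hy
  constructor <;> omega

/-- The frequencies in the central box, without `0`. -/
def box (m : ℕ) [NeZero m] : Finset (ZMod m × ZMod m) :=
  univ.filter fun z => z ≠ 0 ∧ 4 * |z.1.valMinAbs| < m ∧ 4 * |z.2.valMinAbs| < m

/-- Whether `z` lies in the first or third quadrant. -/
def OddQuadrant (z : ZMod m × ZMod m) : Prop :=
  (0 < z.1.valMinAbs ∧ 0 ≤ z.2.valMinAbs) ∨ (z.1.valMinAbs < 0 ∧ z.2.valMinAbs ≤ 0)

open Classical in
/-- The vertical shear that moves `z` away from the origin. -/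
noncomputable def outY (z : ZMod m × ZMod m) : ZMod m × ZMod m :=
  if OddQuadrant z then shearY z else shearY.symm z

open Classical in
/-- The horizontal shear that moves `z` away from the origin. -/
noncomputable def outX (z : ZMod m × ZMod m) : ZMod m × ZMod m :=
  if OddQuadrant z then shearX z else shearX.symm z

lemma box_ne {z : ZMod m × ZMod m} (hz : z ∈ box m) :
    z.1.valMinAbs ≠ 0 ∨ z.2.valMinAbs ≠ 0 := by
  by_contra! h
  exact (mem_filter.1 hz).2.1 (prod_ext_valMinAbs (by simpa using h.1) (by simpa using h.2))

lemma outY_val {z : ZMod m × ZMod m} (hz : z ∈ box m) :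
    (OddQuadrant z ∧ (outY z).1.valMinAbs = z.1.valMinAbs ∧
      (outY z).2.valMinAbs = z.1.valMinAbs + z.2.valMinAbs) ∨
    (¬ OddQuadrant z ∧ (outY z).1.valMinAbs = z.1.valMinAbs ∧
      (outY z).2.valMinAbs = z.2.valMinAbs - z.1.valMinAbs) := by
  obtain ⟨-, -, h1, h2⟩ := mem_filter.1 hz
  by_cases h : OddQuadrant z
  · simp [outY, h, shearY, valMinAbs_add_of_small h1 h2]
  · simp [outY, h, shearY, valMinAbs_sub_of_small h2 h1]

lemma outX_val {z : ZMod m × ZMod m} (hz : z ∈ box m) :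
    (OddQuadrant z ∧ (outX z).1.valMinAbs = z.1.valMinAbs + z.2.valMinAbs ∧
      (outX z).2.valMinAbs = z.2.valMinAbs) ∨
    (¬ OddQuadrant z ∧ (outX z).1.valMinAbs = z.1.valMinAbs - z.2.valMinAbs ∧
      (outX z).2.valMinAbs = z.2.valMinAbs) := by
  obtain ⟨-, -, h1, h2⟩ := mem_filter.1 hz
  by_cases h : OddQuadrant z
  · simp [outX, h, shearX, valMinAbs_add_of_small h1 h2]
  · simp [outX, h, shearX, valMinAbs_sub_of_small h1 h2]

/-- An outward shear adds coordinates in absolute value and never changes the quadrant class, so the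
image tells which shear was applied. -/
lemma outY_injOn : Set.InjOn outY (box m : Set (ZMod m × ZMod m)) := by
  intro z hz w hw h
  have h1 := congrArg (fun c => c.1.valMinAbs) h
  have h2 := congrArg (fun c => c.2.valMinAbs) h
  have nz := box_ne hz
  have nw := box_ne hw
  rcases outY_val hz with ⟨o, a, b⟩ | ⟨o, a, b⟩ <;> rcases outY_val hw with ⟨o', a', b'⟩ | ⟨o', a', b'⟩ <;>
    unfold OddQuadrant at o o' <;> apply prod_ext_valMinAbs <;> omega

lemma outX_injOn : Set.InjOn outX (box m : Set (ZMod m × ZMod m)) := by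
  intro z hz w hw h
  have h1 := congrArg (fun c => c.1.valMinAbs) h
  have h2 := congrArg (fun c => c.2.valMinAbs) h
  have nz := box_ne hz
  have nw := box_ne hw
  rcases outX_val hz with ⟨o, a, b⟩ | ⟨o, a, b⟩ <;> rcases outX_val hw with ⟨o', a', b'⟩ | ⟨o', a', b'⟩ <;>
    unfold OddQuadrant at o o' <;> apply prod_ext_valMinAbs <;> omega

/-- Vertical images satisfy `|x| ≤ |y|` and horizontal ones `|y| ≤ |x|`. On the diagonals the
half-open quadrants decide: vertical images there have coordinates of equal sign, horizontal ones of
opposite sign. -/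
lemma outY_ne_outX {z w : ZMod m × ZMod m} (hz : z ∈ box m) (hw : w ∈ box m) :
    outY z ≠ outX w := by
  intro h
  have h1 := congrArg (fun c => c.1.valMinAbs) h
  have h2 := congrArg (fun c => c.2.valMinAbs) h
  have nz := box_ne hz
  have nw := box_ne hw
  rcases outY_val hz with ⟨o, a, b⟩ | ⟨o, a, b⟩ <;> rcases outX_val hw with ⟨o', a', b'⟩ | ⟨o', a', b'⟩ <;>
    unfold OddQuadrant at o o' <;> omega

lemma outY_ne_zero {z : ZMod m × ZMod m} (hz : z ∈ box m) : outY z ≠ 0 := by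
  intro h
  have h1 : (outY z).1.valMinAbs = 0 := by rw [h]; simp
  have h2 : (outY z).2.valMinAbs = 0 := by rw [h]; simp
  have nz := box_ne hz
  rcases outY_val hz with ⟨o, a, b⟩ | ⟨o, a, b⟩ <;> omega

lemma outX_ne_zero {z : ZMod m × ZMod m} (hz : z ∈ box m) : outX z ≠ 0 := by
  intro h
  have h1 : (outX z).1.valMinAbs = 0 := by rw [h]; simp
  have h2 : (outX z).2.valMinAbs = 0 := by rw [h]; simp
  have nz := box_ne hz
  rcases outX_val hz with ⟨o, a, b⟩ | ⟨o, a, b⟩ <;> omega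

lemma sum_out_le (g : ZMod m × ZMod m → ℝ) :
    ∑ z ∈ box m, (g (outY z) ^ 2 + g (outX z) ^ 2) ≤ ∑ z ∈ univ.erase 0, g z ^ 2 := by
  rw [sum_add_distrib, ← sum_image (f := fun z => g z ^ 2) outY_injOn,
    ← sum_image (f := fun z => g z ^ 2) outX_injOn, ← sum_union]
  · refine sum_le_sum_of_subset_of_nonneg ?_ fun _ _ _ => sq_nonneg _
    intro z hz
    simp only [mem_union, mem_image] at hz
    rcases hz with ⟨w, hw, rfl⟩ | ⟨w, hw, rfl⟩
    · simpa using outY_ne_zero hw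
    · simpa using outX_ne_zero hw
  · rw [disjoint_left]
    intro z hz hz'
    obtain ⟨a, ha, rfl⟩ := mem_image.1 hz
    obtain ⟨b, hb, h⟩ := mem_image.1 hz'
    exact outY_ne_outX ha hb h.symm

/-- The outward shear is `σ` at some points and its inverse at others; both give the same total
variation, whence the factor `2`. -/
lemma sum_sq_piecewise_le (g : ZMod m × ZMod m → ℝ) (σ : ZMod m × ZMod m ≃ ZMod m × ZMod m)
    (P : ZMod m × ZMod m → ZMod m × ZMod m) (hP : ∀ z, P z = σ z ∨ P z = σ.symm z)
    (A : Finset (ZMod m × ZMod m)) :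
    ∑ z ∈ A, (g (P z) - g z) ^ 2 ≤ 2 * ∑ z, (g (σ z) - g z) ^ 2 := by
  have h2 : ∑ z, (g (σ.symm z) - g z) ^ 2 = ∑ z, (g (σ z) - g z) ^ 2 := by
    rw [← σ.sum_comp]
    refine sum_congr rfl fun z _ => ?_
    rw [σ.symm_apply_apply]; ring
  calc _ ≤ ∑ z, (g (P z) - g z) ^ 2 :=
        sum_le_sum_of_subset_of_nonneg (subset_univ _) fun _ _ _ => sq_nonneg _
    _ ≤ ∑ z, ((g (σ z) - g z) ^ 2 + (g (σ.symm z) - g z) ^ 2) := by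
        refine sum_le_sum fun z _ => ?_
        rcases hP z with h | h <;> rw [h] <;>
          linarith [sq_nonneg (g (σ z) - g z), sq_nonneg (g (σ.symm z) - g z)]
    _ = _ := by rw [sum_add_distrib, h2]; ring

lemma sum_box_le (g : ZMod m × ZMod m → ℝ) :
    2 * ∑ z ∈ box m, g z ^ 2 ≤ 3 / 2 * ∑ z ∈ univ.erase 0, g z ^ 2
      + 6 * (∑ z, (g (shearY z) - g z) ^ 2 + ∑ z, (g (shearX z) - g z) ^ 2) := by
  have hY := sum_sq_piecewise_le g shearY outY
    (fun z => by unfold outY; split_ifs <;> simp) (box m)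
  have hX := sum_sq_piecewise_le g shearX outX
    (fun z => by unfold outX; split_ifs <;> simp) (box m)
  have h := sum_out_le g
  -- The coefficient of `b ^ 2` has to stay below `2`: each box frequency counts twice on the left,
  -- while its two images count once each in the total mass.
  have key : ∀ a b : ℝ, a ^ 2 ≤ 3 / 2 * b ^ 2 + 3 * (b - a) ^ 2 := by
    intro a b; nlinarith [sq_nonneg (3 * b - 2 * a)]
  have : ∑ z ∈ box m, 2 * g z ^ 2 ≤ ∑ z ∈ box m,
      (3 / 2 * (g (outY z) ^ 2 + g (outX z) ^ 2)
        + 3 * ((g (outY z) - g z) ^ 2 + (g (outX z) - g z) ^ 2)) :=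
    sum_le_sum fun z _ => by linarith [key (g z) (g (outY z)), key (g z) (g (outX z))]
  rw [← mul_sum, sum_add_distrib, ← mul_sum, ← mul_sum, sum_add_distrib (f := fun z => (g (outY z) - g z) ^ 2)] at this
  linarith

/-- The spectral gap of the shears and unit translations of `(ZMod m)²`. -/
theorem spectral_gap (f : ZMod m × ZMod m → ℂ) :
    (m : ℝ) ^ 2 * ∑ z, ‖f z‖ ^ 2 - ‖∑ z, f z‖ ^ 2 ≤ (m : ℝ) ^ 2 *
      (2 * (energy f transX + energy f transY) + 12 * (energy f shearX + energy f shearY)) := by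
  set g : ZMod m × ZMod m → ℝ := fun c => ‖dft₂ f c‖ with hg
  have hM : ∑ z ∈ univ.erase 0, g z ^ 2 = (m : ℝ) ^ 2 * ∑ z, ‖f z‖ ^ 2 - ‖∑ z, f z‖ ^ 2 := by
    rw [← sum_norm_sq_dft₂, ← dft₂_zero, ← sum_erase_add _ _ (mem_univ (0 : ZMod m × ZMod m))]
    ring
  have h1 := sum_box_le g
  have h2 := sum_norm_shearX_le f
  have h3 := sum_norm_shearY_le f
  -- Outside the box some coordinate is at least `m / 4` in absolute value, and the translation in
  -- that direction moves its phase by a squared distance of at least `2`.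
  have h4 : 2 * (∑ z ∈ univ.erase 0, g z ^ 2 - ∑ z ∈ box m, g z ^ 2)
      ≤ (m : ℝ) ^ 2 * (energy f transX + energy f transY) := by
    have hsub : box m ⊆ univ.erase 0 := fun z hz => by
      simpa using (mem_filter.1 hz).2.1
    rw [← sum_trans_le, ← sum_sdiff hsub, add_sub_cancel_right, mul_sum]
    refine (sum_le_sum fun z hz => ?_).trans
      (sum_le_sum_of_subset_of_nonneg (subset_univ _) fun z _ _ => by positivity)
    simp only [box, mem_sdiff, mem_erase, mem_univ, and_true, mem_filter, true_and, not_and,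
      not_lt] at hz
    refine mul_le_mul_of_nonneg_right ?_ (sq_nonneg _)
    by_cases h : 4 * |z.1.valMinAbs| < m
    · have := two_le_norm_stdAddChar_sub_one (hz.2 hz.1 h)
      linarith [sq_nonneg ‖(ZMod.stdAddChar z.1 : ℂ) - 1‖]
    · have := two_le_norm_stdAddChar_sub_one (not_lt.1 h)
      linarith [sq_nonneg ‖(ZMod.stdAddChar z.2 : ℂ) - 1‖]
  -- Adding the two bounds gives `2 M ≤ 3/2 M + …` for the mass `M` off the zero frequency; the
  -- surplus `M / 2` explains the constants `2` and `12`.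
  rw [hM] at h1 h4
  linarith

end Quadrants

/-! ### From the spectral gap to vertex expansion -/

section SetExpansion

variable {m : ℕ} [NeZero m]

/-- The indicator function of `X`. -/
noncomputable def ind (X : Finset (ZMod m × ZMod m)) (z : ZMod m × ZMod m) : ℂ :=
  if z ∈ X then 1 else 0

/-- The energy of an indicator counts the points at which `σ` enters or leaves `X`. A permutation
enters as often as it leaves, and the exits land injectively in `Y \ X`. -/
lemma energy_ind_le {X Y : Finset (ZMod m × ZMod m)} (σ : ZMod m × ZMod m ≃ ZMod m × ZMod m)
    (hXY : X ⊆ Y) (hσ : ∀ z ∈ X, σ z ∈ Y) :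
    energy (ind X) σ ≤ 2 * ((Y.card : ℝ) - X.card) := by
  set D := univ.filter fun z => z ∈ X ∧ σ z ∉ X with hD
  set D' := univ.filter fun z => σ z ∈ X ∧ z ∉ X with hD'
  have hk : D.card ≤ (Y \ X).card :=
    card_le_card_of_injOn σ (fun z hz => by
      have := (mem_filter.1 hz).2
      exact mem_coe.2 (mem_sdiff.2 ⟨hσ z this.1, this.2⟩)) σ.injective.injOn
  have hpre : (univ.filter fun z => σ z ∈ X).card = X.card :=
    card_bij (fun z _ => σ z) (fun z hz => (mem_filter.1 hz).2)
      (fun a _ b _ h => σ.injective h)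
      (fun b hb => ⟨σ.symm b, by simpa using hb, by simp⟩)
  have h1 : D.card + (univ.filter fun z => z ∈ X ∧ σ z ∈ X).card = X.card := by
    rw [← card_union_of_disjoint]
    · congr 1; ext z; simp only [hD, mem_union, mem_filter, mem_univ, true_and]; tauto
    · rw [disjoint_left]; intro z; simp only [hD, mem_filter, mem_univ, true_and]; tauto
  have h2 : D'.card + (univ.filter fun z => z ∈ X ∧ σ z ∈ X).card = X.card := by
    rw [← card_union_of_disjoint, ← hpre]
    · congr 1; ext z; simp only [hD', mem_union, mem_filter, mem_univ, true_and]; tauto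
    · rw [disjoint_left]; intro z; simp only [hD', mem_filter, mem_univ, true_and]; tauto
  have h3 : energy (ind X) σ = D.card + D'.card := by
    rw [energy, card_filter, card_filter]
    push_cast
    rw [← sum_add_distrib]
    refine sum_congr rfl fun z _ => ?_
    by_cases h : z ∈ X <;> by_cases h' : σ z ∈ X <;> simp [ind, h, h']
  have h4 := card_sdiff_add_card_eq_card hXY
  have : (D.card : ℝ) = D'.card := by exact_mod_cast (by omega : D.card = D'.card)
  have h5 : (D.card : ℝ) ≤ (Y.card : ℝ) - X.card := by
    rw [← h4]; push_cast; have : (D.card : ℝ) ≤ (Y \ X).card := by exact_mod_cast hk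
    linarith
  rw [h3]; linarith

/-- Differences of indicators have modulus `0` or `1`, so their squares obey the triangle
inequality. It is needed because the expander contains translations only after a shear. -/
lemma energy_ind_trans_le (X : Finset (ZMod m × ZMod m))
    (σ τ : ZMod m × ZMod m ≃ ZMod m × ZMod m) :
    energy (ind X) τ ≤ energy (ind X) (σ.trans τ) + energy (ind X) σ := by
  rw [energy, ← σ.sum_comp, energy, energy, ← sum_add_distrib]
  refine sum_le_sum fun z _ => ?_
  by_cases h1 : z ∈ X <;> by_cases h2 : σ z ∈ X <;> by_cases h3 : τ (σ z) ∈ X <;>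
    simp [ind, h1, h2, h3]

/-- Vertex expansion of the Gabber–Galil graph. -/
theorem vertex_expansion {X Y : Finset (ZMod m × ZMod m)} (h0 : X ⊆ Y)
    (h1 : ∀ z ∈ X, shearY z ∈ Y) (h2 : ∀ z ∈ X, transY (shearY z) ∈ Y)
    (h3 : ∀ z ∈ X, shearX z ∈ Y) (h4 : ∀ z ∈ X, transX (shearX z) ∈ Y) :
    (X.card : ℝ) * ((m : ℝ) ^ 2 - X.card) ≤ 64 * (m : ℝ) ^ 2 * ((Y.card : ℝ) - X.card) := by
  have e1 := energy_ind_le shearY h0 h1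
  have e2 := energy_ind_le (shearY.trans transY) h0 h2
  have e3 := energy_ind_le shearX h0 h3
  have e4 := energy_ind_le (shearX.trans transX) h0 h4
  have t1 := energy_ind_trans_le X shearY transY
  have t2 := energy_ind_trans_le X shearX transX
  have h := spectral_gap (ind X)
  have s1 : ∑ z, ‖ind X z‖ ^ 2 = (X.card : ℝ) := by
    have : ∀ z, ‖ind X z‖ ^ 2 = if z ∈ X then (1 : ℝ) else 0 := by
      intro z; by_cases hz : z ∈ X <;> simp [ind, hz]
    simp [this]
  have s2 : ‖∑ z, ind X z‖ ^ 2 = (X.card : ℝ) ^ 2 := by simp [ind]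
  rw [s1, s2] at h
  -- Each shear costs `2 (|Y| - |X|)` and each translation twice that: `2 (4 + 4) + 12 (2 + 2) =
  -- 64`.
  have hb : 2 * (energy (ind X) transX + energy (ind X) transY) +
      12 * (energy (ind X) shearX + energy (ind X) shearY) ≤ 64 * ((Y.card : ℝ) - X.card) := by
    linarith
  nlinarith [mul_le_mul_of_nonneg_left hb (sq_nonneg (m : ℝ))]

end SetExpansion

/-! ### Transport to `{1, …, m²}` and growth of the odds over the layers -/

section Transport

/-- The permutation `σ'_k` of `{1, …, m²}`. -/
def ggMap (m : ℕ) (k : Fin 5) (j : ℕ) : ℕ := pairToInt m (ggPerm m k (intToPair m j))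

lemma getParentsGG_eq (m j : ℕ) : getParentsGG m j = univ.image fun k => ggMap m k j := rfl

lemma intToPair_pairToInt {m : ℕ} {p : ℕ × ℕ} (h : p.2 < m) :
    intToPair m (pairToInt m p) = p := by
  have hm : 0 < m := by omega
  simp only [intToPair, pairToInt, Nat.add_sub_cancel]
  ext
  · rw [mul_comm, Nat.mul_add_div hm, Nat.div_eq_of_lt h, add_zero]
  · rw [mul_comm, Nat.mul_add_mod, Nat.mod_eq_of_lt h]

lemma pairToInt_mem {m : ℕ} {p : ℕ × ℕ} (h1 : p.1 < m) (h2 : p.2 < m) :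
    pairToInt m p ∈ Icc 1 (m ^ 2) := by
  simp only [pairToInt, mem_Icc]
  constructor
  · omega
  · nlinarith

lemma pairToInt_intToPair {m j : ℕ} (hj : j ∈ Icc 1 (m ^ 2)) :
    pairToInt m (intToPair m j) = j := by
  have := (mem_Icc.1 hj).1
  simp only [pairToInt, intToPair]
  have := Nat.div_add_mod (j - 1) m
  rw [mul_comm]; omega

lemma intToPair_lt {m j : ℕ} (hm : 0 < m) (hj : j ∈ Icc 1 (m ^ 2)) :
    (intToPair m j).1 < m ∧ (intToPair m j).2 < m := by
  have := mem_Icc.1 hj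
  refine ⟨(Nat.div_lt_iff_lt_mul hm).2 ?_, Nat.mod_lt _ hm⟩
  rw [← pow_two]; omega

lemma ggMap_zero {m j : ℕ} (hj : j ∈ Icc 1 (m ^ 2)) : ggMap m 0 j = j :=
  pairToInt_intToPair hj

lemma self_mem_layered (i : ℕ) {m j : ℕ} (hj : j ∈ Icc 1 (m ^ 2)) :
    j ∈ getParentsLayered i m j := by
  induction i with
  | zero => simp [getParentsLayered]
  | succ i ih =>
    refine mem_biUnion.2 ⟨j, ?_, ih⟩
    rw [getParentsGG_eq]
    exact mem_image.2 ⟨0, mem_univ _, ggMap_zero hj⟩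

variable {m : ℕ} [NeZero m]

/-- The numbering of `(ZMod m)²` by `{1, …, m²}`. -/
def code (z : ZMod m × ZMod m) : ℕ := pairToInt m (z.1.val, z.2.val)

lemma code_injective : Function.Injective (code : ZMod m × ZMod m → ℕ) := by
  intro z w h
  have h := congrArg (intToPair m) h
  rw [code, code, intToPair_pairToInt (ZMod.val_lt _), intToPair_pairToInt (ZMod.val_lt _)] at h
  exact Prod.ext (ZMod.val_injective m (congrArg Prod.fst h))
    (ZMod.val_injective m (congrArg Prod.snd h))

lemma code_mem (z : ZMod m × ZMod m) : code z ∈ Icc 1 (m ^ 2) :=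
  pairToInt_mem (ZMod.val_lt _) (ZMod.val_lt _)

lemma exists_code {j : ℕ} (hj : j ∈ Icc 1 (m ^ 2)) : ∃ z : ZMod m × ZMod m, code z = j := by
  obtain ⟨h1, h2⟩ := intToPair_lt (Nat.pos_of_ne_zero (NeZero.ne m)) hj
  refine ⟨(((intToPair m j).1 : ℕ), ((intToPair m j).2 : ℕ)), ?_⟩
  rw [code, ZMod.val_natCast_of_lt h1, ZMod.val_natCast_of_lt h2, pairToInt_intToPair hj]

lemma mod_eq_val (x y : ZMod m) : (x.val + y.val) % m = (x + y).val := (ZMod.val_add x y).symm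

lemma mod_succ_eq_val (x y : ZMod m) : (x.val + y.val + 1) % m = (x + y + 1).val := by
  rw [← ZMod.val_natCast]; push_cast; simp

lemma ggMap_code (k : Fin 5) (z : ZMod m × ZMod m) : ggMap m k (code z) =
    code (![z, shearY z, transY (shearY z), shearX z, transX (shearX z)] k) := by
  rw [ggMap, code, intToPair_pairToInt (ZMod.val_lt _), code]
  congr 1
  fin_cases k <;> simp [ggPerm, shearX, shearY, transX, transY, mod_eq_val, mod_succ_eq_val]

lemma ggMap_mem (k : Fin 5) {j : ℕ} (hj : j ∈ Icc 1 (m ^ 2)) : ggMap m k j ∈ Icc 1 (m ^ 2) := by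
  obtain ⟨z, rfl⟩ := exists_code hj
  rw [ggMap_code]; exact code_mem _

/-- One layer multiplies the odds of `X` by at least `1 + 1/64`. -/
lemma odds_layer {X : Finset ℕ} (hX : X ⊆ Icc 1 (m ^ 2)) :
    (1 + 1 / 64) * X.card * ((m : ℝ) ^ 2 - (X.biUnion (getParentsGG m)).card)
      ≤ (X.biUnion (getParentsGG m)).card * ((m : ℝ) ^ 2 - X.card) := by
  set Y := X.biUnion (getParentsGG m) with hY
  have hmY : ∀ k, ∀ j ∈ X, ggMap m k j ∈ Y := fun k j hj =>
    mem_biUnion.2 ⟨j, hj, by rw [getParentsGG_eq]; exact mem_image_of_mem _ (mem_univ k)⟩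
  have hYs : Y ⊆ Icc 1 (m ^ 2) := by
    intro y hy
    obtain ⟨j, hj, hy⟩ := mem_biUnion.1 hy
    rw [getParentsGG_eq] at hy
    obtain ⟨k, -, rfl⟩ := mem_image.1 hy
    exact ggMap_mem k (hX hj)
  have hcard : ∀ Z : Finset ℕ, Z ⊆ Icc 1 (m ^ 2) →
      (univ.filter fun z : ZMod m × ZMod m => code z ∈ Z).card = Z.card := fun Z hZ =>
    card_bij (fun z _ => code z) (fun z hz => (mem_filter.1 hz).2)
      (fun a _ b _ h => code_injective h)
      (fun b hb => by
        obtain ⟨z, rfl⟩ := exists_code (hZ hb)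
        exact ⟨z, by simpa using hb, rfl⟩)
  have hk : ∀ k : Fin 5, ∀ z : ZMod m × ZMod m, code z ∈ X →
      code (![z, shearY z, transY (shearY z), shearX z, transX (shearX z)] k) ∈ Y := by
    intro k z hz
    rw [← ggMap_code]; exact hmY k _ hz
  have h := vertex_expansion (X := univ.filter fun z : ZMod m × ZMod m => code z ∈ X)
    (Y := univ.filter fun z : ZMod m × ZMod m => code z ∈ Y)
    (fun z hz => by simpa using hk 0 z (by simpa using hz))
    (fun z hz => by simpa using hk 1 z (by simpa using hz))
    (fun z hz => by simpa using hk 2 z (by simpa using hz))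
    (fun z hz => by simpa using hk 3 z (by simpa using hz))
    (fun z hz => by simpa using hk 4 z (by simpa using hz))
  rw [hcard X hX, hcard Y hYs] at h
  have hXY : X.card ≤ Y.card := card_le_card fun j hj => by
    simpa [ggMap_zero (hX hj)] using hmY 0 j hj
  have hm : (0 : ℝ) < (m : ℝ) ^ 2 := by
    have : (m : ℝ) ≠ 0 := by exact_mod_cast NeZero.ne m
    positivity
  have hXY' : (X.card : ℝ) ≤ Y.card := by exact_mod_cast hXY
  -- With `M = m²`, the difference `|Y| (M - |X|) - |X| (M - |Y|)` equals `M (|Y| - |X|)`, which by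
  -- `h` is at least `|X| (M - |X|) / 64 ≥ |X| (M - |Y|) / 64`.
  nlinarith [mul_le_mul_of_nonneg_left hXY' (Nat.cast_nonneg (α := ℝ) X.card)]

lemma layered_mem (i : ℕ) {j y : ℕ} (hj : j ∈ Icc 1 (m ^ 2))
    (hy : y ∈ getParentsLayered i m j) : y ∈ Icc 1 (m ^ 2) := by
  induction i generalizing j with
  | zero => simp only [getParentsLayered, mem_singleton] at hy; rwa [hy]
  | succ i ih =>
    obtain ⟨j', hj', hy⟩ := mem_biUnion.1 hy
    rw [getParentsGG_eq] at hj'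
    obtain ⟨k, -, rfl⟩ := mem_image.1 hj'
    exact ih (ggMap_mem k hj) hy

/-- The odds are compared in cross-multiplied form, which still makes sense when a layer fills all
of `{1, …, m²}`. -/
lemma odds_layered (i : ℕ) {X : Finset ℕ} (hX : X ⊆ Icc 1 (m ^ 2)) :
    (1 + 1 / 64) ^ i * X.card * ((m : ℝ) ^ 2 - (X.biUnion (getParentsLayered i m)).card)
      ≤ (X.biUnion (getParentsLayered i m)).card * ((m : ℝ) ^ 2 - X.card) := by
  have hle : ∀ Z : Finset ℕ, Z ⊆ Icc 1 (m ^ 2) → (Z.card : ℝ) ≤ (m : ℝ) ^ 2 := fun Z hZ => by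
    have := card_le_card hZ
    rw [Nat.card_Icc, Nat.add_sub_cancel] at this
    exact_mod_cast this
  induction i generalizing X with
  | zero => simp [getParentsLayered, biUnion_singleton_eq_self]
  | succ i ih =>
    set Y := X.biUnion (getParentsGG m) with hY
    have hYs : Y ⊆ Icc 1 (m ^ 2) := by
      intro y hy
      obtain ⟨j, hj, hy⟩ := mem_biUnion.1 hy
      rw [getParentsGG_eq] at hy
      obtain ⟨k, -, rfl⟩ := mem_image.1 hy
      exact ggMap_mem k (hX hj)
    have hZ : X.biUnion (getParentsLayered (i + 1) m) = Y.biUnion (getParentsLayered i m) := by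
      rw [hY, biUnion_biUnion]; rfl
    rw [hZ]
    set Z := Y.biUnion (getParentsLayered i m) with hZd
    have hZs : Z ⊆ Icc 1 (m ^ 2) := by
      intro z hz
      obtain ⟨j, hj, hz⟩ := mem_biUnion.1 hz
      exact layered_mem i (hYs hj) hz
    have h1 := odds_layer hX
    have h2 := ih hYs
    rw [← hY] at h1
    rw [← hZd] at h2
    have hYZ : (Y.card : ℝ) ≤ Z.card := by
      exact_mod_cast card_le_card fun y hy => mem_biUnion.2 ⟨y, hy, self_mem_layered i (hYs hy)⟩
    have bX := hle X hX
    have bY := hle Y hYs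
    have bZ := hle Z hZs
    rcases bY.eq_or_lt with hYe | hYl
    · have : (Z.card : ℝ) = (m : ℝ) ^ 2 := le_antisymm bZ (hYe ▸ hYZ)
      rw [this, sub_self, mul_zero]
      exact mul_nonneg (sq_nonneg _) (by linarith)
    · have hp : (0 : ℝ) < (m : ℝ) ^ 2 - Y.card := by linarith
      refine le_of_mul_le_mul_right ?_ hp
      calc _ = (1 + 1 / 64) ^ i * ((1 + 1 / 64) * X.card * ((m : ℝ) ^ 2 - Y.card))
              * ((m : ℝ) ^ 2 - Z.card) := by rw [pow_succ]; ring
        _ ≤ (1 + 1 / 64) ^ i * (Y.card * ((m : ℝ) ^ 2 - X.card)) * ((m : ℝ) ^ 2 - Z.card) := by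
            have : (0 : ℝ) ≤ (m : ℝ) ^ 2 - Z.card := by linarith
            gcongr
        _ = ((1 + 1 / 64) ^ i * Y.card * ((m : ℝ) ^ 2 - Z.card)) * ((m : ℝ) ^ 2 - X.card) := by
            ring
        _ ≤ (Z.card * ((m : ℝ) ^ 2 - Y.card)) * ((m : ℝ) ^ 2 - X.card) := by
            have : (0 : ℝ) ≤ (m : ℝ) ^ 2 - X.card := by linarith
            gcongr
        _ = _ := by ring

end Transport

/-! ### The bipartite expanders -/

section BipartiteExpander

lemma ggConst_pos : 0 < ggConst := by
  have : Real.sqrt 3 < 2 := by rw [Real.sqrt_lt' (by norm_num)]; norm_num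
  unfold ggConst; linarith

lemma ggConst_lt : ggConst < 1 / 10 := by
  have : 1.7 < Real.sqrt 3 := by rw [Real.lt_sqrt (by norm_num)]; norm_num
  unfold ggConst; linarith

/-- The layer count is tuned to growth `1 + c δ` and target `(1 - δ) / δ`. Passing from odds `δ / (1
- δ)` to the inverse odds needs the square of that target, and for small `δ` the available rate `1 +
1/64` is at least `(1 + c δ)²`. -/
lemma lt_pow_numLayers {δ : ℝ} (h0 : 0 < δ) (h1 : δ ≤ 1 / 20) :
    ((1 - δ) / δ) ^ 2 < (1 + 1 / 64 : ℝ) ^ numLayers δ := by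
  have hc := ggConst_pos
  have hc' := ggConst_lt
  set q := 1 + ggConst * δ with hq
  have hq1 : 1 < q := by have := mul_pos hc h0; linarith
  have hl : 0 < Real.log q := Real.log_pos hq1
  have hr : 0 < (1 - δ) / δ := div_pos (by linarith) h0
  have hlt : (1 - δ) / δ < q ^ numLayers δ := by
    rw [← Real.log_lt_log_iff hr (by positivity), Real.log_pow, ← div_lt_iff₀ hl, numLayers]
    push_cast
    exact (Nat.le_ceil _).trans_lt (lt_add_one _)
  have hqq : q ^ 2 ≤ 1 + 1 / 64 := by
    have h2 : ggConst * δ ≤ 1 / 200 := by nlinarith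
    rw [hq]; nlinarith [mul_pos hc h0]
  calc ((1 - δ) / δ) ^ 2 < (q ^ numLayers δ) ^ 2 := by gcongr
    _ = (q ^ 2) ^ numLayers δ := by rw [← pow_mul, ← pow_mul, mul_comm]
    _ ≤ _ := by gcongr

lemma sideLen_spec (N : ℕ) : 0 < sideLen N ∧ N ≤ sideLen N ^ 2 :=
  Nat.sInf_mem (s := {m : ℕ | 0 < m ∧ N ≤ m ^ 2}) ⟨N + 1, by omega, by nlinarith⟩

lemma sideLen_le {N m : ℕ} (hm : 0 < m) (h : N ≤ m ^ 2) : sideLen N ≤ m :=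
  Nat.sInf_le ⟨hm, h⟩

lemma sideLen_eq {N m : ℕ} (h : N ≤ (m + 1) ^ 2) (h' : m ^ 2 < N) : sideLen N = m + 1 := by
  refine le_antisymm (sideLen_le (by omega) h) ?_
  have h2 := (sideLen_spec N).2
  by_contra hlt
  have : sideLen N ^ 2 ≤ m ^ 2 := Nat.pow_le_pow_left (by omega) 2
  omega

/-- For even `t` the number is a perfect square; for `t = 2 k + 1` the side `2 * 2 ^ k` already
suffices. -/
lemma sideLen_sq_le (t : ℕ) : sideLen (2 ^ t) ^ 2 ≤ 2 * 2 ^ t := by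
  obtain ⟨h0, h⟩ := sideLen_spec (2 ^ t)
  rcases Nat.even_or_odd' t with ⟨k, rfl | rfl⟩
  · have : sideLen (2 ^ (2 * k)) ≤ 2 ^ k :=
      sideLen_le (by positivity) (by rw [← pow_mul, mul_comm])
    have := Nat.pow_le_pow_left this 2
    rw [← pow_mul, mul_comm k 2] at this
    omega
  · have : sideLen (2 ^ (2 * k + 1)) ≤ 2 * 2 ^ k := by
      refine sideLen_le (by positivity) ?_
      rw [mul_pow, ← pow_mul, pow_succ, mul_comm k 2]; omega
    have := Nat.pow_le_pow_left this 2
    rw [mul_pow, ← pow_mul, mul_comm k 2] at this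
    have := pow_succ 2 (2 * k)
    omega

/-- `getParentsBE (2 ^ t) δ` is a `δ`-expander. -/
theorem exists_mem_getParentsBE {δ : ℝ} (h0 : 0 < δ) (h1 : δ ≤ 1 / 10) {t : ℕ} {A B : Finset ℕ}
    (hA : A ⊆ Icc 1 (2 ^ t)) (hB : B ⊆ Icc 1 (2 ^ t)) (hAc : δ * 2 ^ t ≤ A.card)
    (hBc : δ * 2 ^ t ≤ B.card) : ∃ j ∈ B, ∃ u ∈ A, u ∈ getParentsBE (2 ^ t) δ j := by
  obtain ⟨hs0, hs⟩ := sideLen_spec (2 ^ t)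
  have hs2 := sideLen_sq_le t
  set m := sideLen (2 ^ t) with hm
  have : NeZero m := ⟨by omega⟩
  have hsub : Icc 1 (2 ^ t) ⊆ Icc 1 (m ^ 2) := Icc_subset_Icc_right hs
  -- Rounding up to a square at most doubles the ground set, so sets of density `δ` in `2 ^ t` keep
  -- density `δ / 2` in `m²`.
  set d := δ / 2 with hd
  have hm2 : (m : ℝ) ^ 2 ≤ 2 * 2 ^ t := by exact_mod_cast hs2
  have hmpos : (0 : ℝ) < (m : ℝ) ^ 2 := by
    have : (0 : ℝ) < m := by exact_mod_cast hs0
    positivity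
  have hA' : d * (m : ℝ) ^ 2 ≤ A.card := by nlinarith
  have hB' : d * (m : ℝ) ^ 2 ≤ B.card := by nlinarith
  have hd0 : 0 < d := by linarith
  set L := numLayers d with hL
  set Y := B.biUnion (getParentsLayered L m) with hY
  have hYs : Y ⊆ Icc 1 (m ^ 2) := by
    intro y hy
    obtain ⟨j, hj, hy⟩ := mem_biUnion.1 hy
    exact layered_mem L (hsub (hB hj)) hy
  have hodds := odds_layered L (hB.trans hsub)
  rw [← hY] at hodds
  -- Otherwise the odds of `Y` are at most `(1 - d) / d`, although they exceed the initial odds, at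
  -- least `d / (1 - d)`, by a factor greater than `((1 - d) / d) ^ 2`. Once `Y` is this large, it
  -- must meet `A`.
  have hYc : (1 - d) * (m : ℝ) ^ 2 < Y.card := by
    by_contra! hcon
    have hpow := lt_pow_numLayers hd0 (by linarith : d ≤ 1 / 20)
    rw [div_pow, div_lt_iff₀ (by positivity)] at hpow
    have c1 : (Y.card : ℝ) * ((m : ℝ) ^ 2 - B.card)
        ≤ ((1 - d) * (m : ℝ) ^ 2) * ((1 - d) * (m : ℝ) ^ 2) := by
      have : (0 : ℝ) ≤ (1 - d) * (m : ℝ) ^ 2 := mul_nonneg (by linarith) hmpos.le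
      have h3 : (m : ℝ) ^ 2 - B.card ≤ (1 - d) * (m : ℝ) ^ 2 := by linarith
      calc _ ≤ (Y.card : ℝ) * ((1 - d) * (m : ℝ) ^ 2) := by gcongr
        _ ≤ _ := by gcongr
    have c2 : (1 + 1 / 64 : ℝ) ^ L * (d * (m : ℝ) ^ 2) * (d * (m : ℝ) ^ 2) ≤
        (1 + 1 / 64) ^ L * B.card * ((m : ℝ) ^ 2 - Y.card) := by
      have : d * (m : ℝ) ^ 2 ≤ (m : ℝ) ^ 2 - Y.card := by linarith
      gcongr
    have c3 : (1 + 1 / 64 : ℝ) ^ L * d ^ 2 * ((m : ℝ) ^ 2 * (m : ℝ) ^ 2)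
        ≤ (1 - d) ^ 2 * ((m : ℝ) ^ 2 * (m : ℝ) ^ 2) := by linarith
    have := le_of_mul_le_mul_right c3 (by positivity)
    linarith
  have hne : ¬ Disjoint A Y := by
    intro hdis
    have h3 := card_union_of_disjoint hdis
    have h4 := card_le_card (union_subset (hA.trans hsub) hYs)
    rw [h3, Nat.card_Icc, Nat.add_sub_cancel] at h4
    have : (A.card : ℝ) + Y.card ≤ (m : ℝ) ^ 2 := by exact_mod_cast h4
    linarith
  obtain ⟨u, huA, huY⟩ := not_disjoint_iff.1 hne
  obtain ⟨j, hj, hu⟩ := mem_biUnion.1 huY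
  exact ⟨j, hj, u, huA, mem_inter.2 ⟨hA huA, hu⟩⟩

end BipartiteExpander

/-! ### Local expansion of the graph via dyadic blocks -/

section LocalExpander

/-- Adjacency of `G(δ, 2 ^ n)` on natural numbers. -/
def Edge (δ : ℝ) (n u v : ℕ) : Prop := u ∈ getParentsEGS δ n v ∧ u ≠ v

lemma edge_of_near {δ : ℝ} {n u v : ℕ} (h1 : u ∈ Icc 1 (2 ^ n)) (h2 : u < v)
    (h3 : v ≤ u + 4 * n) : Edge δ n u v := by
  refine ⟨mem_inter.2 ⟨mem_union_left _ (mem_Ico.2 ⟨by omega, h2⟩), h1⟩, h2.ne⟩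

lemma edge_of_far {δ : ℝ} {n t a u v i : ℕ} (ht : 1 ≤ t) (h1 : u ∈ Icc 1 (2 ^ n)) (h2 : u ≠ v)
    (hi : 1 ≤ i) (hi' : i ≤ 10) (hv : v / 2 ^ t = a + i) (hu : a * 2 ^ t ≤ u)
    (h : u - a * 2 ^ t ∈ getParentsBE (2 ^ t) (δ / 5) (v % 2 ^ t + 1)) : Edge δ n u v := by
  refine ⟨mem_inter.2 ⟨mem_union_right _ (mem_biUnion.2 ⟨t, mem_Icc.2 ⟨ht, ?_⟩, ?_⟩), h1⟩, h2⟩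
  · have h3 : 2 ^ t ≤ v := by
      by_contra! hlt
      rw [Nat.div_eq_of_lt hlt] at hv; omega
    calc t = Nat.clog 2 (2 ^ t) := (Nat.clog_pow 2 t (by norm_num)).symm
      _ ≤ _ := Nat.clog_mono_right 2 h3
  · refine mem_biUnion.2 ⟨_, h, mem_image.2 ⟨i, mem_Icc.2 ⟨hi, by omega⟩, ?_⟩⟩
    rw [hv, Nat.add_sub_cancel]; omega

/-- As `i ≥ 1` and `y ≤ 2 ^ t`, a far parent is at most the start of the block of `v`; equality with
`v` can occur and is excluded by `u ≠ v`. -/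
lemma edge_lt {δ : ℝ} {n u v : ℕ} (h : Edge δ n u v) : u < v := by
  obtain ⟨h, hne⟩ := h
  refine lt_of_le_of_ne ?_ hne
  rcases mem_union.1 (mem_inter.1 h).1 with h | h
  · exact (mem_Ico.1 h).2.le
  · obtain ⟨t, -, h⟩ := mem_biUnion.1 h
    obtain ⟨y, hy, h⟩ := mem_biUnion.1 h
    obtain ⟨i, hi, rfl⟩ := mem_image.1 h
    have h1 := (mem_Icc.1 (mem_inter.1 hy).1).2
    have h2 := mem_Icc.1 hi
    obtain ⟨q, hq⟩ : ∃ q, v / 2 ^ t = q + i := ⟨v / 2 ^ t - i, by omega⟩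
    calc (v / 2 ^ t - i) * 2 ^ t + y ≤ q * 2 ^ t + 2 ^ t := by rw [hq, Nat.add_sub_cancel]; omega
      _ = (q + 1) * 2 ^ t := by ring
      _ ≤ v / 2 ^ t * 2 ^ t := Nat.mul_le_mul_right _ (by omega)
      _ ≤ v := Nat.div_mul_le_self _ _

variable {δ : ℝ} {n : ℕ}

/-- Parents have offsets in `{1, …, 2 ^ t}` and children residues in `{0, …, 2 ^ t - 1}`. Hence
blocks of `A` are open on the left and blocks of `B` open on the right. -/
lemma exists_edge_far (h0 : 0 < δ) (h1 : δ ≤ 1 / 2) {t a b : ℕ} (ht : 1 ≤ t) {A B : Finset ℕ}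
    (hA : ∀ u ∈ A, u ∈ Icc 1 (2 ^ n) ∧ a * 2 ^ t < u ∧ u ≤ (a + 1) * 2 ^ t)
    (hB : ∀ v ∈ B, v / 2 ^ t = b) (hab : a < b) (hba : b ≤ a + 10)
    (hlt : ∀ u ∈ A, ∀ v ∈ B, u < v)
    (hAc : δ / 5 * 2 ^ t ≤ A.card) (hBc : δ / 5 * 2 ^ t ≤ B.card) :
    ∃ u ∈ A, ∃ v ∈ B, Edge δ n u v := by
  have hp : 0 < 2 ^ t := by positivity
  have iA : Set.InjOn (fun u => u - a * 2 ^ t) (A : Set ℕ) := fun u hu w hw h => by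
    have := (hA u hu).2.1; have := (hA w hw).2.1
    simp only at h; omega
  have iB : Set.InjOn (fun v => v % 2 ^ t + 1) (B : Set ℕ) := fun u hu w hw h => by
    rw [← Nat.div_add_mod u (2 ^ t), ← Nat.div_add_mod w (2 ^ t), hB u hu, hB w hw]
    simp only at h; omega
  obtain ⟨j, hj, y, hy, hmem⟩ := exists_mem_getParentsBE (δ := δ / 5) (by linarith) (by linarith)
    (t := t) (A := A.image fun u => u - a * 2 ^ t) (B := B.image fun v => v % 2 ^ t + 1)
    (fun y hy => by
      obtain ⟨u, hu, rfl⟩ := mem_image.1 hy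
      have := (hA u hu).2
      rw [add_mul, one_mul] at this
      exact mem_Icc.2 ⟨by omega, by omega⟩)
    (fun j hj => by
      obtain ⟨v, hv, rfl⟩ := mem_image.1 hj
      have := Nat.mod_lt v hp
      exact mem_Icc.2 ⟨by omega, by omega⟩)
    (by rwa [card_image_of_injOn iA]) (by rwa [card_image_of_injOn iB])
  obtain ⟨u, hu, rfl⟩ := mem_image.1 hy
  obtain ⟨v, hv, rfl⟩ := mem_image.1 hj
  exact ⟨u, hu, v, hv, edge_of_far (i := b - a) ht (hA u hu).1 (hlt u hu v hv).ne (by omega)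
    (by omega) (by rw [hB v hv]; omega) (hA u hu).2.1.le hmem⟩

/-- Split the block in half. If `A` is dense in the left half and `B` in the right half, adjacent
blocks of the lower level give the edge. Otherwise one of the sets is dense in the other half, and
the order `A < B` forces both relevant sets into that half, where the argument repeats. At level `0`
the order is contradictory. -/
lemma exists_edge_block (h0 : 0 < δ) (h1 : δ ≤ 1 / 2) (t : ℕ) {a : ℕ} {A B : Finset ℕ}
    (hA : ∀ u ∈ A, u ∈ Icc 1 (2 ^ n) ∧ a * 2 ^ t < u ∧ u ≤ (a + 1) * 2 ^ t)
    (hB : ∀ v ∈ B, v / 2 ^ t = a) (hlt : ∀ u ∈ A, ∀ v ∈ B, u < v)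
    (hAc : δ / 5 * 2 ^ t ≤ A.card) (hBc : δ / 5 * 2 ^ t ≤ B.card) :
    ∃ u ∈ A, ∃ v ∈ B, Edge δ n u v := by
  induction t generalizing a A B with
  | zero =>
    have hA0 : 0 < A.card := by
      have : (0 : ℝ) < A.card := lt_of_lt_of_le (by positivity) hAc
      exact_mod_cast this
    have hB0 : 0 < B.card := by
      have : (0 : ℝ) < B.card := lt_of_lt_of_le (by positivity) hBc
      exact_mod_cast this
    obtain ⟨u, hu⟩ := card_pos.1 hA0
    obtain ⟨v, hv⟩ := card_pos.1 hB0
    have := hlt u hu v hv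
    have := (hA u hu).2.1
    have := hB v hv
    simp at *; omega
  | succ t ih =>
    have hp : 0 < 2 ^ t := by positivity
    have hpr : (0 : ℝ) < δ / 5 * 2 ^ t := by positivity
    have e1 : ∀ c, c * 2 ^ (t + 1) = 2 * c * 2 ^ t := fun c => by ring
    rw [pow_succ] at hAc hBc
    have hBs : ∀ v ∈ B, 2 * a * 2 ^ t ≤ v ∧ v < (2 * a + 2) * 2 ^ t := by
      intro v hv
      have h2 := hB v hv
      have h3 : 0 < 2 ^ (t + 1) := by positivity
      have h4 : a * 2 ^ (t + 1) ≤ v := by rw [← h2]; exact Nat.div_mul_le_self _ _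
      have h5 : v < (a + 1) * 2 ^ (t + 1) := by
        rw [← Nat.div_lt_iff_lt_mul h3, h2]; omega
      rw [e1] at h4 h5
      exact ⟨h4, by rwa [mul_add] at h5⟩
    have hAs : ∀ u ∈ A, 2 * a * 2 ^ t < u ∧ u ≤ (2 * a + 2) * 2 ^ t := by
      intro u hu
      have h2 := (hA u hu).2
      rw [e1, e1, mul_add] at h2
      exact h2
    have em : (2 * a + 1) * 2 ^ t = 2 * a * 2 ^ t + 2 ^ t := by ring
    have em2 : (2 * a + 2) * 2 ^ t = 2 * a * 2 ^ t + 2 ^ t + 2 ^ t := by ring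
    set c := 2 * a * 2 ^ t with hc
    have hdiv : ∀ v q, v / 2 ^ t = q ↔ q * 2 ^ t ≤ v ∧ v < q * 2 ^ t + 2 ^ t := by
      intro v q
      rw [Nat.div_eq_iff hp]; constructor <;> rintro ⟨h, h'⟩ <;> constructor <;> lia
    set A₀ := A.filter (· ≤ c + 2 ^ t) with hA₀
    set B₁ := B.filter (c + 2 ^ t ≤ ·) with hB₁
    by_cases hcA : δ / 5 * 2 ^ t ≤ A₀.card
    · by_cases hcB : δ / 5 * 2 ^ t ≤ B₁.card
      · rcases Nat.eq_zero_or_pos t with rfl | ht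
        · obtain ⟨u, hu⟩ := card_pos.1 (by exact_mod_cast hpr.trans_le hcA : 0 < A₀.card)
          obtain ⟨v, hv⟩ := card_pos.1 (by exact_mod_cast hpr.trans_le hcB : 0 < B₁.card)
          have hu := mem_filter.1 hu
          have hv := mem_filter.1 hv
          have := hAs u hu.1
          have := hBs v hv.1
          have := hlt u hu.1 v hv.1
          simp only [pow_zero] at *; omega
        · obtain ⟨u, hu, v, hv, h⟩ := exists_edge_far (n := n) (A := A₀) (B := B₁)
            (a := 2 * a) (b := 2 * a + 1) h0 h1 ht
            (fun u hu => by
              have hu := mem_filter.1 hu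
              exact ⟨(hA u hu.1).1, (hAs u hu.1).1, by rw [em]; exact hu.2⟩)
            (fun v hv => by
              have hv := mem_filter.1 hv
              have := hBs v hv.1
              rw [hdiv, em]; omega)
            (by omega) (by omega)
            (fun u hu v hv => hlt u (mem_filter.1 hu).1 v (mem_filter.1 hv).1) hcA hcB
          exact ⟨u, (mem_filter.1 hu).1, v, (mem_filter.1 hv).1, h⟩
      · have hB₀ : δ / 5 * 2 ^ t ≤ (B.filter fun v => ¬ (c + 2 ^ t ≤ v)).card := by
          have := card_filter_add_card_filter_not (s := B) (c + 2 ^ t ≤ ·)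
          have : (B₁.card : ℝ) + (B.filter fun v => ¬ (c + 2 ^ t ≤ v)).card = B.card := by
            exact_mod_cast this
          linarith
        obtain ⟨w, hw⟩ := card_pos.1 (by exact_mod_cast hpr.trans_le hB₀ : 0 < (B.filter fun v => ¬ (c + 2 ^ t ≤ v)).card)
        have hw := mem_filter.1 hw
        obtain ⟨u, hu, v, hv, h⟩ := ih (a := 2 * a) (A := A)
          (B := B.filter fun v => ¬ (c + 2 ^ t ≤ v))
          (fun u hu => by
            have := hlt u hu w hw.1
            exact ⟨(hA u hu).1, (hAs u hu).1, by rw [em]; omega⟩)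
          (fun v hv => by
            have hv := mem_filter.1 hv
            have := hBs v hv.1
            rw [hdiv]; omega)
          (fun u hu v hv => hlt u hu v (mem_filter.1 hv).1) (by linarith) hB₀
        exact ⟨u, hu, v, (mem_filter.1 hv).1, h⟩
    · have hA₁ : δ / 5 * 2 ^ t ≤ (A.filter fun v => ¬ (v ≤ c + 2 ^ t)).card := by
        have := card_filter_add_card_filter_not (s := A) (· ≤ c + 2 ^ t)
        have : (A₀.card : ℝ) + (A.filter fun v => ¬ (v ≤ c + 2 ^ t)).card = A.card := by
          exact_mod_cast this
        linarith
      obtain ⟨w, hw⟩ := card_pos.1 (by exact_mod_cast hpr.trans_le hA₁ : 0 < (A.filter fun v => ¬ (v ≤ c + 2 ^ t)).card)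
      have hw := mem_filter.1 hw
      obtain ⟨u, hu, v, hv, h⟩ := ih (a := 2 * a + 1) (B := B)
        (A := A.filter fun v => ¬ (v ≤ c + 2 ^ t))
        (fun u hu => by
          have hu := mem_filter.1 hu
          have := hAs u hu.1
          exact ⟨(hA u hu.1).1, by rw [em]; omega, this.2⟩)
        (fun v hv => by
          have := hBs v hv
          have := hlt w hw.1 v hv
          rw [hdiv, em]; omega)
        (fun u hu v hv => hlt u (mem_filter.1 hu).1 v hv) hA₁ (by linarith)
      exact ⟨u, (mem_filter.1 hu).1, v, hv, h⟩

/-- Any two large sets in a window of length `2 r + 1`, one before the other, are joined by an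
edge. -/
def IsLocalExpander (E : ℕ → ℕ → Prop) (N : ℕ) (δ : ℝ) : Prop :=
  ∀ (p r : ℕ) (A B : Finset ℕ), 1 ≤ r → (∀ u ∈ A, u ∈ Icc 1 N ∧ p ≤ u) →
    (∀ v ∈ B, v ∈ Icc 1 N ∧ v ≤ p + 2 * r) → (∀ u ∈ A, ∀ v ∈ B, u < v) →
    δ * r ≤ A.card → δ * r ≤ B.card → ∃ u ∈ A, ∃ v ∈ B, E u v

lemma exists_heavy_fiber {θ : ℝ} {A : Finset ℕ} (f : ℕ → ℕ) (q : ℕ)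
    (hf : ∀ u ∈ A, f u ∈ Ico q (q + 5)) (hA : 5 * θ ≤ A.card) :
    ∃ a ∈ Ico q (q + 5), θ ≤ (A.filter fun u => f u = a).card :=
  exists_le_card_fiber_of_nsmul_le_card_of_maps_to hf ⟨q, by simp⟩ (by simpa using hA)

theorem isLocalExpander_edge (h0 : 0 < δ) (h1 : δ ≤ 1 / 2) (hn : 1 ≤ n) :
    IsLocalExpander (Edge δ n) (2 ^ n) δ := by
  intro p r A B hr hA hB hlt hAc hBc
  have hrr : (0 : ℝ) < δ * r := by
    have : (0 : ℝ) < r := by exact_mod_cast hr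
    positivity
  obtain ⟨u₀, hu₀⟩ := card_pos.1 (by exact_mod_cast hrr.trans_le hAc : 0 < A.card)
  obtain ⟨v₀, hv₀⟩ := card_pos.1 (by exact_mod_cast hrr.trans_le hBc : 0 < B.card)
  rcases hr.eq_or_lt with rfl | hr2
  -- For `r = 1` the two nodes are at distance at most `2 ≤ 4 n`, so a near edge joins them.
  · refine ⟨u₀, hu₀, v₀, hv₀, edge_of_near (hA u₀ hu₀).1 (hlt _ hu₀ _ hv₀) ?_⟩
    have := (hA u₀ hu₀).2; have := (hB v₀ hv₀).2; omega
  -- With `2 ^ t ≤ r < 2 ^ (t + 1)` the window meets at most five blocks of length `2 ^ t`, whence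
  -- the density `δ / 5`. Two such blocks differ by at most `4`, within the allowed shift `10`.
  set t := Nat.log 2 r with ht
  have ht1 : 1 ≤ t := Nat.log_pos (by norm_num) hr2
  have hl : 2 ^ t ≤ r := Nat.pow_log_le_self 2 (by omega)
  have hl' : r < 2 * 2 ^ t := by
    have := Nat.lt_pow_succ_log_self (b := 2) (by norm_num) r
    rw [← ht, pow_succ] at this; omega
  have hp : 0 < 2 ^ t := by positivity
  set q := (p - 1) / 2 ^ t with hq
  have hq1 : q * 2 ^ t ≤ p - 1 := Nat.div_mul_le_self _ _
  have hq2 : p - 1 < (q + 1) * 2 ^ t := by rw [← Nat.div_lt_iff_lt_mul hp]; omega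
  have hup : ∀ v ∈ B, v < (q + 5) * 2 ^ t := by
    intro v hv
    have := (hB v hv).2
    have e : (q + 5) * 2 ^ t = (q + 1) * 2 ^ t + 4 * 2 ^ t := by ring
    omega
  have hfA : ∀ u ∈ A, (u - 1) / 2 ^ t ∈ Ico q (q + 5) := by
    intro u hu
    have := (hA u hu).2
    have := hlt u hu v₀ hv₀
    have := hup v₀ hv₀
    exact mem_Ico.2 ⟨Nat.div_le_div_right (by omega),
      (Nat.div_lt_iff_lt_mul hp).2 (by omega)⟩
  have hfB : ∀ v ∈ B, v / 2 ^ t ∈ Ico q (q + 5) := by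
    intro v hv
    have := (hA u₀ hu₀).2
    have := hlt u₀ hu₀ v hv
    exact mem_Ico.2 ⟨Nat.div_le_div_right (by omega), (Nat.div_lt_iff_lt_mul hp).2 (hup v hv)⟩
  have hl2 : (2 : ℝ) ^ t ≤ r := by exact_mod_cast hl
  have h5 : 5 * (δ / 5 * 2 ^ t) ≤ δ * r := by nlinarith
  obtain ⟨a, ha, hac⟩ := exists_heavy_fiber _ q hfA (h5.trans hAc)
  obtain ⟨b, hb, hbc⟩ := exists_heavy_fiber _ q hfB (h5.trans hBc)
  set A' := A.filter fun u => (u - 1) / 2 ^ t = a with hA'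
  set B' := B.filter fun v => v / 2 ^ t = b with hB'
  have hA's : ∀ u ∈ A', u ∈ Icc 1 (2 ^ n) ∧ a * 2 ^ t < u ∧ u ≤ (a + 1) * 2 ^ t := by
    intro u hu
    have hu := mem_filter.1 hu
    have h2 := (hA u hu.1).1
    have h3 := mem_Icc.1 h2
    have h4 : a * 2 ^ t ≤ u - 1 := by rw [← hu.2]; exact Nat.div_mul_le_self _ _
    have h5 : u - 1 < (a + 1) * 2 ^ t := by rw [← Nat.div_lt_iff_lt_mul hp]; omega
    exact ⟨h2, by omega, by omega⟩
  have hB's : ∀ v ∈ B', v / 2 ^ t = b := fun v hv => (mem_filter.1 hv).2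
  have hlt' : ∀ u ∈ A', ∀ v ∈ B', u < v := fun u hu v hv =>
    hlt u (mem_filter.1 hu).1 v (mem_filter.1 hv).1
  have hpr : (0 : ℝ) < δ / 5 * 2 ^ t := by positivity
  obtain ⟨u₁, hu₁⟩ := card_pos.1 (by exact_mod_cast hpr.trans_le hac : 0 < A'.card)
  obtain ⟨v₁, hv₁⟩ := card_pos.1 (by exact_mod_cast hpr.trans_le hbc : 0 < B'.card)
  have hab : a ≤ b := by
    rw [← hB's v₁ hv₁, Nat.le_div_iff_mul_le hp]
    have := hlt' u₁ hu₁ v₁ hv₁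
    have := (hA's u₁ hu₁).2.1
    omega
  have hb' := mem_Ico.1 hb
  have ha' := mem_Ico.1 ha
  have : ∃ u ∈ A', ∃ v ∈ B', Edge δ n u v := by
    rcases hab.eq_or_lt with rfl | hab
    · exact exists_edge_block h0 h1 t hA's hB's hlt' hac hbc
    · exact exists_edge_far h0 h1 ht1 hA's hB's hab (by omega) hlt' hac hbc
  obtain ⟨u, hu, v, hv, h⟩ := this
  exact ⟨u, (mem_filter.1 hu).1, v, (mem_filter.1 hv).1, h⟩

end LocalExpander

/-! ### Deleting nodes from a local expander -/

section Robust

/-- An edge of `E` between undeleted nodes of `[N]`. -/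
def Step (E : ℕ → ℕ → Prop) (N : ℕ) (S : Finset ℕ) (u v : ℕ) : Prop :=
  E u v ∧ u ∈ Icc 1 N \ S ∧ v ∈ Icc 1 N \ S

/-- Every interval of `[N]` that starts at `x` contains at least a `γ`-fraction of undeleted
nodes. -/
def GoodRight (N : ℕ) (S : Finset ℕ) (γ : ℝ) (x : ℕ) : Prop :=
  ∀ r, 1 ≤ r → x + r ≤ N + 1 → γ * r ≤ (Ico x (x + r) \ S).card

/-- Every interval of `[N]` that ends at `x` contains at least a `γ`-fraction of undeleted
nodes. -/
def GoodLeft (N : ℕ) (S : Finset ℕ) (γ : ℝ) (x : ℕ) : Prop :=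
  ∀ r, 1 ≤ r → r ≤ x → x ≤ N → γ * r ≤ (Ioc (x - r) x \ S).card

variable {E : ℕ → ℕ → Prop} {N : ℕ} {S : Finset ℕ} {δ γ : ℝ}

open Relation Classical

/-- Halve the interval. At least `2 δ h` nodes of the first half are undeleted and at most `δ h` of
them unreachable, so at least `δ h` are reachable. Expansion then leaves fewer than `δ h`
unreachable nodes in the rest, and `2 δ h ≤ δ r`. -/
lemma card_unreachable_right_le (hE : IsLocalExpander E N δ) (h0 : 0 ≤ δ) (hγ : 2 * δ ≤ γ) {x : ℕ}
    (hx1 : 1 ≤ x) (hx : GoodRight N S γ x) (r : ℕ) (hr : 1 ≤ r) (hxr : x + r ≤ N + 1) :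
    (((Ico x (x + r) \ S).filter fun v => ¬ ReflTransGen (Step E N S) x v).card : ℝ)
      ≤ δ * r := by
  induction r using Nat.strong_induction_on with
  | _ r ih =>
  rcases hr.eq_or_lt with rfl | hr2
  · have : ((Ico x (x + 1) \ S).filter fun v => ¬ ReflTransGen (Step E N S) x v) = ∅ := by
      refine filter_eq_empty_iff.2 fun v hv => ?_
      have := mem_Ico.1 (mem_sdiff.1 hv).1
      obtain rfl : v = x := by omega
      exact not_not.2 ReflTransGen.refl
    rw [this]; simpa using h0
  set h := r / 2 with hh
  have hh1 : 1 ≤ h := by omega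
  have i1 := ih h (by omega) hh1 (by omega)
  have g1 := hx h hh1 (by omega)
  set A := (Ico x (x + h) \ S).filter fun v => ReflTransGen (Step E N S) x v with hA
  set A' := (Ico x (x + h) \ S).filter fun v => ¬ ReflTransGen (Step E N S) x v with hA'
  set B := (Ico (x + h) (x + r) \ S).filter fun v => ¬ ReflTransGen (Step E N S) x v with hB
  have hAA : (A.card : ℝ) + A'.card = (Ico x (x + h) \ S).card := by
    exact_mod_cast card_filter_add_card_filter_not _
  have hh0 : (0 : ℝ) ≤ h := by positivity
  have hAc : δ * h ≤ A.card := by nlinarith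
  have mB : ∀ v ∈ B, (x + h ≤ v ∧ v < x + r) ∧ v ∉ S ∧ ¬ ReflTransGen (Step E N S) x v := by
    intro v hv
    have hv := mem_filter.1 hv
    have := mem_sdiff.1 hv.1
    exact ⟨mem_Ico.1 this.1, this.2, hv.2⟩
  have mA : ∀ v ∈ A, (x ≤ v ∧ v < x + h) ∧ v ∉ S ∧ ReflTransGen (Step E N S) x v := by
    intro v hv
    have hv := mem_filter.1 hv
    have := mem_sdiff.1 hv.1
    exact ⟨mem_Ico.1 this.1, this.2, hv.2⟩
  have hBc : (B.card : ℝ) < δ * h := by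
    by_contra! hcon
    -- For odd `r` the interval has `2 h + 1` nodes, exactly the window length in `IsLocalExpander`.
    obtain ⟨u, hu, v, hv, huv⟩ := hE x h A B hh1
      (fun u hu => by have := mA u hu; exact ⟨mem_Icc.2 ⟨by omega, by omega⟩, by omega⟩)
      (fun v hv => by have := mB v hv; exact ⟨mem_Icc.2 ⟨by omega, by omega⟩, by omega⟩)
      (fun u hu v hv => by have := mA u hu; have := mB v hv; omega) hAc hcon
    obtain ⟨a1, a2, a3⟩ := mA u hu
    obtain ⟨b1, b2, b3⟩ := mB v hv
    exact b3 (a3.tail ⟨huv, mem_sdiff.2 ⟨mem_Icc.2 ⟨by omega, by omega⟩, a2⟩,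
      mem_sdiff.2 ⟨mem_Icc.2 ⟨by omega, by omega⟩, b2⟩⟩)
  have hsub : ((Ico x (x + r) \ S).filter fun v => ¬ ReflTransGen (Step E N S) x v) ⊆ A' ∪ B := by
    intro v hv
    simp only [hA', hB, mem_union, mem_filter, mem_sdiff, mem_Ico] at hv ⊢
    by_cases hvh : v < x + h
    · exact Or.inl ⟨⟨⟨hv.1.1.1, hvh⟩, hv.1.2⟩, hv.2⟩
    · exact Or.inr ⟨⟨⟨not_lt.1 hvh, hv.1.1.2⟩, hv.1.2⟩, hv.2⟩
  have hc : (((Ico x (x + r) \ S).filter fun v => ¬ ReflTransGen (Step E N S) x v).card : ℝ)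
      ≤ A'.card + B.card := by
    exact_mod_cast (card_le_card hsub).trans (card_union_le _ _)
  have : (2 : ℝ) * h ≤ r := by exact_mod_cast (by omega : 2 * h ≤ r)
  nlinarith

lemma card_unreachable_left_le (hE : IsLocalExpander E N δ) (h0 : 0 ≤ δ) (hγ : 2 * δ ≤ γ) {x : ℕ}
    (hxN : x ≤ N) (hx : GoodLeft N S γ x) (r : ℕ) (hr : 1 ≤ r) (hxr : r ≤ x) :
    (((Ioc (x - r) x \ S).filter fun v => ¬ ReflTransGen (Step E N S) v x).card : ℝ)
      ≤ δ * r := by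
  induction r using Nat.strong_induction_on with
  | _ r ih =>
  rcases hr.eq_or_lt with rfl | hr2
  · have : ((Ioc (x - 1) x \ S).filter fun v => ¬ ReflTransGen (Step E N S) v x) = ∅ := by
      refine filter_eq_empty_iff.2 fun v hv => ?_
      have := mem_Ioc.1 (mem_sdiff.1 hv).1
      obtain rfl : v = x := by omega
      exact not_not.2 ReflTransGen.refl
    rw [this]; simpa using h0
  set h := r / 2 with hh
  have hh1 : 1 ≤ h := by omega
  have i1 := ih h (by omega) hh1 (by omega)
  have g1 := hx h hh1 (by omega) hxN
  set B := (Ioc (x - h) x \ S).filter fun v => ReflTransGen (Step E N S) v x with hB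
  set B' := (Ioc (x - h) x \ S).filter fun v => ¬ ReflTransGen (Step E N S) v x with hB'
  set A := (Ioc (x - r) (x - h) \ S).filter fun v => ¬ ReflTransGen (Step E N S) v x with hA
  have hBB : (B.card : ℝ) + B'.card = (Ioc (x - h) x \ S).card := by
    exact_mod_cast card_filter_add_card_filter_not _
  have hh0 : (0 : ℝ) ≤ h := by positivity
  have hBc : δ * h ≤ B.card := by nlinarith
  have mA : ∀ v ∈ A, (x - r < v ∧ v ≤ x - h) ∧ v ∉ S ∧ ¬ ReflTransGen (Step E N S) v x := by
    intro v hv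
    have hv := mem_filter.1 hv
    have := mem_sdiff.1 hv.1
    exact ⟨mem_Ioc.1 this.1, this.2, hv.2⟩
  have mB : ∀ v ∈ B, (x - h < v ∧ v ≤ x) ∧ v ∉ S ∧ ReflTransGen (Step E N S) v x := by
    intro v hv
    have hv := mem_filter.1 hv
    have := mem_sdiff.1 hv.1
    exact ⟨mem_Ioc.1 this.1, this.2, hv.2⟩
  have hAc : (A.card : ℝ) < δ * h := by
    by_contra! hcon
    obtain ⟨u, hu, v, hv, huv⟩ := hE (x - 2 * h) h A B hh1
      (fun u hu => by have := mA u hu; exact ⟨mem_Icc.2 ⟨by omega, by omega⟩, by omega⟩)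
      (fun v hv => by have := mB v hv; exact ⟨mem_Icc.2 ⟨by omega, by omega⟩, by omega⟩)
      (fun u hu v hv => by have := mA u hu; have := mB v hv; omega) hcon hBc
    obtain ⟨a1, a2, a3⟩ := mA u hu
    obtain ⟨b1, b2, b3⟩ := mB v hv
    exact a3 (b3.head ⟨huv, mem_sdiff.2 ⟨mem_Icc.2 ⟨by omega, by omega⟩, a2⟩,
      mem_sdiff.2 ⟨mem_Icc.2 ⟨by omega, by omega⟩, b2⟩⟩)
  have hsub : ((Ioc (x - r) x \ S).filter fun v => ¬ ReflTransGen (Step E N S) v x) ⊆ B' ∪ A := by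
    intro v hv
    simp only [hA, hB', mem_union, mem_filter, mem_sdiff, mem_Ioc] at hv ⊢
    by_cases hvh : x - h < v
    · exact Or.inl ⟨⟨⟨hvh, hv.1.1.2⟩, hv.1.2⟩, hv.2⟩
    · exact Or.inr ⟨⟨⟨hv.1.1.1, not_lt.1 hvh⟩, hv.1.2⟩, hv.2⟩
  have hc : (((Ioc (x - r) x \ S).filter fun v => ¬ ReflTransGen (Step E N S) v x).card : ℝ)
      ≤ B'.card + A.card := by
    exact_mod_cast (card_le_card hsub).trans (card_union_le _ _)
  have : (2 : ℝ) * h ≤ r := by exact_mod_cast (by omega : 2 * h ≤ r)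
  nlinarith

/-- Good nodes are connected in `G - S`. -/
lemma transGen_of_good (hE : IsLocalExpander E N δ) (h0 : 0 ≤ δ) (hγ : 2 * δ ≤ γ) {x y : ℕ}
    (hx1 : 1 ≤ x) (hxy : x < y) (hyN : y ≤ N) (hx : GoodRight N S γ x) (hy : GoodLeft N S γ y) :
    TransGen (Step E N S) x y := by
  -- The largest length for which the interval after `x` and the one before `y` are disjoint; each
  -- contains at least `δ h` nodes connected to its end, and one edge bridges them.
  set h := (y - x + 1) / 2 with hh
  have hh1 : 1 ≤ h := by omega
  have i1 := card_unreachable_right_le hE h0 hγ hx1 hx h hh1 (by omega)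
  have i2 := card_unreachable_left_le hE h0 hγ hyN hy h hh1 (by omega)
  have g1 := hx h hh1 (by omega)
  have g2 := hy h hh1 (by omega) hyN
  have hA : (((Ico x (x + h) \ S).filter fun v => ReflTransGen (Step E N S) x v).card : ℝ) +
      ((Ico x (x + h) \ S).filter fun v => ¬ ReflTransGen (Step E N S) x v).card
      = (Ico x (x + h) \ S).card := by
    exact_mod_cast card_filter_add_card_filter_not _
  have hB : (((Ioc (y - h) y \ S).filter fun v => ReflTransGen (Step E N S) v y).card : ℝ) +
      ((Ioc (y - h) y \ S).filter fun v => ¬ ReflTransGen (Step E N S) v y).card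
      = (Ioc (y - h) y \ S).card := by
    exact_mod_cast card_filter_add_card_filter_not _
  have hh0 : (0 : ℝ) ≤ h := by positivity
  obtain ⟨u, hu, v, hv, huv⟩ := hE x h
    ((Ico x (x + h) \ S).filter fun v => ReflTransGen (Step E N S) x v)
    ((Ioc (y - h) y \ S).filter fun v => ReflTransGen (Step E N S) v y) hh1
    (fun u hu => by
      have := mem_Ico.1 (mem_sdiff.1 (mem_filter.1 hu).1).1
      exact ⟨mem_Icc.2 ⟨by omega, by omega⟩, by omega⟩)
    (fun v hv => by
      have := mem_Ioc.1 (mem_sdiff.1 (mem_filter.1 hv).1).1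
      exact ⟨mem_Icc.2 ⟨by omega, by omega⟩, by omega⟩)
    (fun u hu v hv => by
      have := mem_Ico.1 (mem_sdiff.1 (mem_filter.1 hu).1).1
      have := mem_Ioc.1 (mem_sdiff.1 (mem_filter.1 hv).1).1
      omega) (by nlinarith) (by nlinarith)
  obtain ⟨hu, hxu⟩ := mem_filter.1 hu
  obtain ⟨hv, hvy⟩ := mem_filter.1 hv
  obtain ⟨hu1, hu2⟩ := mem_sdiff.1 hu
  obtain ⟨hv1, hv2⟩ := mem_sdiff.1 hv
  have := mem_Ico.1 hu1
  have := mem_Ioc.1 hv1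
  have hst : Step E N S u v := ⟨huv, mem_sdiff.2 ⟨mem_Icc.2 ⟨by omega, by omega⟩, hu2⟩,
    mem_sdiff.2 ⟨mem_Icc.2 ⟨by omega, by omega⟩, hv2⟩⟩
  exact (TransGen.tail' hxu hst).trans_left hvy

lemma card_sparse_le {I : Finset ℕ} {r : ℕ} (hI : I.card = r)
    (h : ((I \ S).card : ℝ) < γ * r) : (1 - γ) * (I \ S).card ≤ γ * (I ∩ S).card := by
  have : ((I \ S).card : ℝ) + (I ∩ S).card = r := by
    rw [← hI]; exact_mod_cast card_sdiff_add_card_inter I S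
  rw [← this] at h; linarith

/-- Scan from left to right: pass over a good or deleted-but-dense start by one step, and at a bad
start jump over its sparse interval. The jumped intervals are disjoint, contain all bad undeleted
nodes, and in each the undeleted nodes number at most `γ / (1 - γ)` times the deleted ones when `γ <
1`. -/
lemma card_bad_right_le (h0 : 0 ≤ γ) (h1 : γ ≤ 1) (l k : ℕ) (hlk : k + l = N + 1) :
    (1 - γ) * (((Ico k (N + 1) \ S).filter fun x => ¬ GoodRight N S γ x).card : ℝ)
      ≤ γ * (Ico k (N + 1) ∩ S).card := by
  induction l using Nat.strong_induction_on generalizing k with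
  | _ l ih =>
  rcases Nat.eq_zero_or_pos l with rfl | hl
  · obtain rfl : k = N + 1 := by omega
    simp
  have split : ∀ r, 1 ≤ r → k + r ≤ N + 1 →
      (1 - γ) * (((Ico k (k + r) \ S).filter fun x => ¬ GoodRight N S γ x).card : ℝ)
        ≤ γ * (Ico k (k + r) ∩ S).card →
      (1 - γ) * (((Ico k (N + 1) \ S).filter fun x => ¬ GoodRight N S γ x).card : ℝ)
        ≤ γ * (Ico k (N + 1) ∩ S).card := by
    intro r hr hkr hc
    have i := ih (l - r) (by omega) (k + r) (by omega)
    have e : Ico k (N + 1) = Ico k (k + r) ∪ Ico (k + r) (N + 1) :=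
      (Ico_union_Ico_eq_Ico (by omega) hkr).symm
    have d : Disjoint (Ico k (k + r)) (Ico (k + r) (N + 1)) := Ico_disjoint_Ico_consecutive _ _ _
    rw [e, union_sdiff_distrib, filter_union, union_inter_distrib_right, card_union_of_disjoint
      (disjoint_filter_filter (d.mono sdiff_subset sdiff_subset)),
      card_union_of_disjoint (d.mono inter_subset_left inter_subset_left)]
    push_cast
    linarith
  by_cases hk : GoodRight N S γ k
  · refine split 1 le_rfl (by omega) ?_
    have : ((Ico k (k + 1) \ S).filter fun x => ¬ GoodRight N S γ x) = ∅ := by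
      refine filter_eq_empty_iff.2 fun v hv => ?_
      have := mem_Ico.1 (mem_sdiff.1 hv).1
      obtain rfl : v = k := by omega
      exact not_not.2 hk
    rw [this]; simp only [card_empty, Nat.cast_zero, mul_zero]; positivity
  · unfold GoodRight at hk
    push Not at hk
    obtain ⟨r, hr, hkr, hc⟩ := hk
    refine split r hr hkr ((mul_le_mul_of_nonneg_left ?_ (by linarith)).trans
      (card_sparse_le (by simp) hc))
    exact_mod_cast card_filter_le _ _

lemma card_bad_left_le (h0 : 0 ≤ γ) (h1 : γ ≤ 1) (k : ℕ) (hk : k ≤ N) :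
    (1 - γ) * (((Ioc 0 k \ S).filter fun x => ¬ GoodLeft N S γ x).card : ℝ)
      ≤ γ * (Ioc 0 k ∩ S).card := by
  induction k using Nat.strong_induction_on with
  | _ k ih =>
  rcases Nat.eq_zero_or_pos k with rfl | hl
  · simp
  have split : ∀ r, 1 ≤ r → r ≤ k →
      (1 - γ) * (((Ioc (k - r) k \ S).filter fun x => ¬ GoodLeft N S γ x).card : ℝ)
        ≤ γ * (Ioc (k - r) k ∩ S).card →
      (1 - γ) * (((Ioc 0 k \ S).filter fun x => ¬ GoodLeft N S γ x).card : ℝ)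
        ≤ γ * (Ioc 0 k ∩ S).card := by
    intro r hr hkr hc
    have i := ih (k - r) (by omega) (by omega)
    have e : Ioc 0 k = Ioc 0 (k - r) ∪ Ioc (k - r) k :=
      (Ioc_union_Ioc_eq_Ioc (by omega) (by omega)).symm
    have d : Disjoint (Ioc 0 (k - r)) (Ioc (k - r) k) := Ioc_disjoint_Ioc_of_le le_rfl
    rw [e, union_sdiff_distrib, filter_union, union_inter_distrib_right, card_union_of_disjoint
      (disjoint_filter_filter (d.mono sdiff_subset sdiff_subset)),
      card_union_of_disjoint (d.mono inter_subset_left inter_subset_left)]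
    push_cast
    linarith
  by_cases hg : GoodLeft N S γ k
  · refine split 1 le_rfl (by omega) ?_
    have : ((Ioc (k - 1) k \ S).filter fun x => ¬ GoodLeft N S γ x) = ∅ := by
      refine filter_eq_empty_iff.2 fun v hv => ?_
      have := mem_Ioc.1 (mem_sdiff.1 hv).1
      obtain rfl : v = k := by omega
      exact not_not.2 hg
    rw [this]; simp only [card_empty, Nat.cast_zero, mul_zero]; positivity
  · unfold GoodLeft at hg
    push Not at hg
    obtain ⟨r, hr, hkr, -, hc⟩ := hg
    refine split r hr hkr ((mul_le_mul_of_nonneg_left ?_ (by linarith)).trans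
      (card_sparse_le (by rw [Nat.card_Ioc]; omega) hc))
    exact_mod_cast card_filter_le _ _

/-- All but `(1 + γ) / (1 - γ) |S|` nodes are good. -/
lemma le_card_good (h0 : 0 ≤ γ) (h1 : γ < 1) :
    (N : ℝ) - (1 + γ) / (1 - γ) * S.card ≤
      ((Icc 1 N \ S).filter fun x => GoodRight N S γ x ∧ GoodLeft N S γ x).card := by
  have b1 := card_bad_right_le (N := N) (S := S) h0 h1.le N 1 (by omega)
  have b2 := card_bad_left_le (N := N) (S := S) h0 h1.le N le_rfl
  have e1 : Ico 1 (N + 1) = Icc 1 N := by ext; simp only [mem_Ico, mem_Icc]; omega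
  have e2 : Ioc 0 N = Icc 1 N := by ext; simp only [mem_Ioc, mem_Icc]; omega
  rw [e1] at b1
  rw [e2] at b2
  have hS : ((Icc 1 N ∩ S).card : ℝ) ≤ S.card := by exact_mod_cast card_le_card inter_subset_right
  have hN : ((Icc 1 N \ S).card : ℝ) + (Icc 1 N ∩ S).card = N := by
    have := card_sdiff_add_card_inter (Icc 1 N) S
    rw [Nat.card_Icc, Nat.add_sub_cancel] at this
    exact_mod_cast this
  set R := (Icc 1 N \ S).filter fun x => ¬ GoodRight N S γ x with hR
  set L := (Icc 1 N \ S).filter fun x => ¬ GoodLeft N S γ x with hL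
  set T := (Icc 1 N \ S).filter fun x => GoodRight N S γ x ∧ GoodLeft N S γ x with hT
  have hc : ((Icc 1 N \ S).card : ℝ) ≤ T.card + (R.card + L.card) := by
    have : Icc 1 N \ S ⊆ T ∪ (R ∪ L) := by
      intro v hv
      simp only [hT, hR, hL, mem_union, mem_filter]
      tauto
    exact_mod_cast (card_le_card this).trans
      ((card_union_le _ _).trans (Nat.add_le_add_left (card_union_le _ _) _))
  have hg : 0 < 1 - γ := by linarith
  have hRc : (R.card : ℝ) ≤ γ / (1 - γ) * S.card := by
    rw [div_mul_eq_mul_div, le_div_iff₀ hg]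
    nlinarith
  have hLc : (L.card : ℝ) ≤ γ / (1 - γ) * S.card := by
    rw [div_mul_eq_mul_div, le_div_iff₀ hg]
    nlinarith
  -- The loss is `|S|` for the deleted nodes and `γ / (1 - γ) |S|` for the bad nodes of either side.
  have : (1 + γ) / (1 - γ) = 1 + 2 * (γ / (1 - γ)) := by field_simp; ring
  rw [this]
  linarith

/-- There is a path of length `k` in `G - S` ending at `v`. -/
def PathTo (E : ℕ → ℕ → Prop) (N : ℕ) (S : Finset ℕ) (v k : ℕ) : Prop :=
  ∃ p : ℕ → ℕ, p k = v ∧ (∀ i < k, Step E N S (p i) (p (i + 1))) ∧ ∀ i ≤ k, p i ∈ Icc 1 N \ S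

lemma PathTo.step {u v k : ℕ} (h : PathTo E N S u k) (huv : Step E N S u v) :
    PathTo E N S v (k + 1) := by
  obtain ⟨p, rfl, hp, hp'⟩ := h
  refine ⟨fun i => if i ≤ k then p i else v, by simp, fun i hi => ?_, fun i hi => ?_⟩
  · rcases (Nat.lt_succ_iff.1 hi).eq_or_lt with rfl | hi
    · simpa using huv
    · simpa [hi.le, Nat.succ_le_of_lt hi] using hp i hi
  · by_cases h : i ≤ k
    · simpa [h] using hp' i h
    · simpa [h] using huv.2.2

/-- Dropping initial edges keeps the endpoint, so paths can be trimmed to an exact length and still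
be extended. -/
lemma PathTo.of_le {v k l : ℕ} (h : PathTo E N S v k) (hl : l ≤ k) : PathTo E N S v l := by
  obtain ⟨p, rfl, hp, hp'⟩ := h
  refine ⟨fun i => p (i + (k - l)), by simp [hl], fun i hi => ?_, fun i hi => hp' _ (by omega)⟩
  have := hp (i + (k - l)) (by omega)
  rwa [show i + (k - l) + 1 = i + 1 + (k - l) by omega] at this

lemma PathTo.transGen {u v k : ℕ} (h : PathTo E N S u k) (huv : TransGen (Step E N S) u v) :
    PathTo E N S v (k + 1) := by
  induction huv with
  | single h' => exact h.step h'
  | tail _ h' ih => exact (ih.step h').of_le (by omega)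

/-- Link the elements of `T` in increasing order; every link contributes at least one edge. -/
lemma exists_pathTo (T : Finset ℕ) (hT : T ⊆ Icc 1 N \ S)
    (hc : ∀ x ∈ T, ∀ y ∈ T, x < y → TransGen (Step E N S) x y) (hne : T.Nonempty) :
    ∃ v ∈ T, (∀ x ∈ T, x ≤ v) ∧ PathTo E N S v (T.card - 1) := by
  induction T using Finset.induction_on_max with
  | empty => simp at hne
  | insert a T ha ih =>
    have hat : a ∉ T := fun h => lt_irrefl _ (ha a h)
    refine ⟨a, mem_insert_self _ _, fun x hx => ?_, ?_⟩
    · rcases mem_insert.1 hx with rfl | hx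
      · exact le_rfl
      · exact (ha x hx).le
    rcases T.eq_empty_or_nonempty with rfl | hTn
    · refine ⟨fun _ => a, rfl, fun i hi => ?_, fun i _ => hT (mem_insert_self _ _)⟩
      simp at hi
    · obtain ⟨v, hv, -, hp⟩ := ih ((subset_insert _ _).trans hT)
        (fun x hx y hy => hc x (mem_insert_of_mem hx) y (mem_insert_of_mem hy)) hTn
      have := hp.transGen (hc v (mem_insert_of_mem hv) a (mem_insert_self _ _) (ha v hv))
      rw [card_insert_of_notMem hat]
      exact this.of_le (by omega)

/-- Deleting `S` from a local expander leaves a path of every length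
`d < N - (1 + γ) / (1 - γ) |S|`. -/
theorem exists_long_path (hE : IsLocalExpander E N δ) (h0 : 0 ≤ δ) (hγ : 2 * δ ≤ γ) (h1 : γ < 1)
    {d : ℕ} (hd : (d : ℝ) < N - (1 + γ) / (1 - γ) * S.card) : ∃ v, PathTo E N S v d := by
  have hg := le_card_good (N := N) (S := S) (by linarith : 0 ≤ γ) h1
  set T := (Icc 1 N \ S).filter fun x => GoodRight N S γ x ∧ GoodLeft N S γ x with hT
  have hdT : d < T.card := by exact_mod_cast hd.trans_le hg
  obtain ⟨v, -, -, hv⟩ := exists_pathTo (E := E) (N := N) (S := S) T (filter_subset _ _)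
    (fun x hx y hy hxy => by
      have hx := mem_filter.1 hx
      have hy := mem_filter.1 hy
      exact transGen_of_good hE h0 hγ (mem_Icc.1 (mem_sdiff.1 hx.1).1).1 hxy
        (mem_Icc.1 (mem_sdiff.1 hy.1).1).2 hx.2.1 hy.2.2) (card_pos.1 (by omega))
  exact ⟨v, hv.of_le (by omega)⟩

end Robust

/-! ### Depth-robustness and indegree of the graph -/

section Graph

lemma egsGraph_adj_iff {δ : ℝ} {n : ℕ} (u v : Node (2 ^ n)) :
    (egsGraph δ n).Adj u v ↔ Edge δ n u v :=
  and_congr_right fun _ => not_congr Subtype.ext_iff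

lemma isAcyclic_egsGraph (δ : ℝ) (n : ℕ) : IsAcyclic (egsGraph δ n) := by
  have h : ∀ u v, Relation.TransGen (egsGraph δ n).Adj u v → (u : ℕ) < v := by
    intro u v h
    induction h with
    | single h => exact edge_lt ((egsGraph_adj_iff _ _).1 h)
    | tail _ h ih => exact ih.trans (edge_lt ((egsGraph_adj_iff _ _).1 h))
  exact fun v hv => lt_irrefl _ (h v v hv)

lemma hasPathAvoiding_of_pathTo {δ : ℝ} {n d v : ℕ} {S : Finset (Node (2 ^ n))}
    (h : PathTo (Edge δ n) (2 ^ n) (S.map (Function.Embedding.subtype _)) v d) :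
    HasPathAvoiding (egsGraph δ n) S d := by
  obtain ⟨p, -, hp, hp'⟩ := h
  refine ⟨fun i => ⟨p i, (mem_sdiff.1 (hp' i (by omega))).1⟩, ?_, fun i => ?_, fun i hi => ?_⟩
  · have hs : StrictMono fun i : Fin (d + 1) => p i :=
      Fin.strictMono_iff_lt_succ.2 fun i => edge_lt (hp i i.2).1
    intro i j hij
    exact hs.injective (congrArg Subtype.val hij)
  · exact (egsGraph_adj_iff _ _).2 (hp i i.2).1
  · exact (mem_sdiff.1 (hp' i (by omega))).2 (mem_map.2 ⟨_, hi, rfl⟩)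

lemma isDelta_iff {ε δ : ℝ} (hε : 0 < ε) :
    IsDelta ε δ ↔ δ = min ε (1 / 3) / (2.1 * (2 + min ε (1 / 3))) := by
  have hμ : 0 < min ε (1 / 3) := lt_min hε (by norm_num)
  unfold IsDelta
  generalize min ε (1 / 3) = μ at *
  constructor
  · intro h
    have h2 : (1 - 2.1 * δ) ≠ 0 := by
      -- A vanishing denominator would make the quotient `0` by convention, but the right side
      -- exceeds `1`.
      intro h0; rw [h0, div_zero] at h; linarith
    rw [div_eq_iff h2] at h
    rw [eq_div_iff (by positivity)]
    linarith
  · rintro rfl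
    have : 1 - 2.1 * (μ / (2.1 * (2 + μ))) ≠ 0 := by
      have : 2.1 * (μ / (2.1 * (2 + μ))) < 1 := by
        rw [mul_div_assoc', div_lt_one (by positivity)]; nlinarith
      linarith
    rw [div_eq_iff this]
    field_simp; ring

lemma isDelta_bounds {ε δ : ℝ} (hε : 0 < ε) (h : IsDelta ε δ) : 0 < δ ∧ δ ≤ 1 / 10 := by
  have hμ : 0 < min ε (1 / 3) := lt_min hε (by norm_num)
  have hμ' : min ε (1 / 3) ≤ 1 / 3 := min_le_right _ _
  rw [(isDelta_iff hε).1 h]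
  refine ⟨by positivity, ?_⟩
  rw [div_le_iff₀ (by positivity)]
  nlinarith

theorem extremeDepthRobust_egsGraph {ε δ : ℝ} (hε : 0 < ε) (h : IsDelta ε δ) {n : ℕ}
    (hn : 1 ≤ n) : ExtremeDepthRobust ε (egsGraph δ n) := by
  obtain ⟨h0, h1⟩ := isDelta_bounds hε h
  refine ⟨isAcyclic_egsGraph δ n, fun e d hed S hS => ?_⟩
  have hcard : Fintype.card (Node (2 ^ n)) = 2 ^ n := by simp
  rw [hcard] at hed
  have hN : (0 : ℝ) < ((2 ^ n : ℕ) : ℝ) := by positivity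
  have hμ : 0 < min ε (1 / 3) := lt_min hε (by norm_num)
  have hμ' : min ε (1 / 3) ≤ ε := min_le_left _ _
  have hS' : (S.card : ℝ) ≤ e := by exact_mod_cast hS
  have hd0 : (0 : ℝ) ≤ d := by positivity
  have he0 : (0 : ℝ) ≤ e := by positivity
  have key : (d : ℝ) < (2 ^ n : ℕ) - (1 + 2.1 * δ) / (1 - 2.1 * δ) *
      (S.map (Function.Embedding.subtype _)).card := by
    rw [card_map, h]
    -- This gives the strict inequality needed: `(1 + min ε (1/3)) e + d ≤ (1 - ε) N + ε e < N`.
    have heN : (e : ℝ) < (2 ^ n : ℕ) := by nlinarith [mul_pos hε hN]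
    have a1 : (1 + min ε (1 / 3)) * S.card ≤ (1 + min ε (1 / 3)) * e := by gcongr
    have a2 : min ε (1 / 3) * e ≤ ε * e := by gcongr
    have a3 : ε * e < ε * (2 ^ n : ℕ) := by gcongr
    linarith
  obtain ⟨v, hv⟩ := exists_long_path (isLocalExpander_edge h0 (by linarith) hn) h0.le
    (by linarith) (by linarith) key
  exact hasPathAvoiding_of_pathTo hv

lemma card_getParentsLayered_le (i m j : ℕ) : (getParentsLayered i m j).card ≤ 5 ^ i := by
  induction i generalizing j with
  | zero => simp [getParentsLayered]
  | succ i ih =>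
    have h5 : (getParentsGG m j).card ≤ 5 := card_image_le.trans (by simp)
    calc _ ≤ (getParentsGG m j).card * 5 ^ i := card_biUnion_le_card_mul _ _ _ fun j' _ => ih j'
      _ ≤ 5 * 5 ^ i := Nat.mul_le_mul_right _ h5
      _ = _ := by ring

theorem indeg_egsGraph_le (δ : ℝ) (n : ℕ) :
    indeg (egsGraph δ n) ≤ (4 + 10 * 5 ^ numLayers (δ / 5 / 2)) * n := by
  refine Finset.sup_le fun v _ => ?_
  set L := numLayers (δ / 5 / 2) with hL
  have h1 : (parents (egsGraph δ n) v).card ≤ (getParentsEGS δ n v).card := by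
    refine card_le_card_of_injOn Subtype.val (fun u hu => ?_) Subtype.val_injective.injOn
    simp only [parents, coe_filter, mem_univ, true_and] at hu
    exact mem_coe.2 ((egsGraph_adj_iff _ _).1 hu).1
  have hv : Nat.clog 2 v ≤ n := Nat.clog_le_of_le_pow (mem_Icc.1 v.2).2
  refine h1.trans ((card_le_card inter_subset_left).trans ((card_union_le _ _).trans ?_))
  have h2 : (Ico (v - 4 * n) (v : ℕ)).card ≤ 4 * n := by rw [Nat.card_Ico]; omega
  have h3 : ((Icc 1 (Nat.clog 2 v)).biUnion fun t =>
      (getParentsBE (2 ^ t) (δ / 5) (v % 2 ^ t + 1)).biUnion fun y =>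
        (Icc 1 (min ((v : ℕ) / 2 ^ t) 10)).image fun i => (v / 2 ^ t - i) * 2 ^ t + y).card
      ≤ n * (5 ^ L * 10) := by
    refine (card_biUnion_le_card_mul _ _ (5 ^ L * 10) fun t _ => ?_).trans ?_
    · refine (card_biUnion_le_card_mul _ _ 10 fun y _ => ?_).trans ?_
      · exact card_image_le.trans (by rw [Nat.card_Icc]; omega)
      · exact Nat.mul_le_mul_right _
          ((card_le_card inter_subset_right).trans (card_getParentsLayered_le _ _ _))
    · exact Nat.mul_le_mul_right _ (by rw [Nat.card_Icc]; omega)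
  calc _ ≤ 4 * n + n * (5 ^ L * 10) := Nat.add_le_add h2 h3
    _ = _ := by ring

end Graph

/-! ### Cost and semantics of loop-free programs -/

section LoopFree

/-- Programs without loops. -/
def LoopFree : Prog → Prop
  | .const _ _ => True
  | .op _ _ _ _ => True
  | .emit _ => True
  | .seq p q => LoopFree p ∧ LoopFree q
  | .ite _ p q => LoopFree p ∧ LoopFree q
  | .while _ _ => False

/-- Final registers and output of a loop-free program (loops are skipped). -/
def run : Prog → (ℕ → ℕ) → (ℕ → ℕ) × List ℕ
  | .const x c, s => (Function.update s x c, [])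
  | .op o x y z, s => (Function.update s x (o.eval (s y) (s z)), [])
  | .emit x, s => (s, [s x])
  | .seq p q, s => ((run q (run p s).1).1, (run p s).2 ++ (run q (run p s).1).2)
  | .ite x p q, s => if s x = 0 then run q s else run p s
  | .while _ _, s => (s, [])

/-- The registers that a program may change. -/
def writes : Prog → Finset ℕ
  | .const x _ => {x}
  | .op _ x _ _ => {x}
  | .emit _ => ∅
  | .seq p q => writes p ∪ writes q
  | .ite _ p q => writes p ∪ writes q
  | .while _ p => writes p

lemma run_frame (p : Prog) (s : ℕ → ℕ) {i : ℕ} (hi : i ∉ writes p) : (run p s).1 i = s i := by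
  induction p generalizing s with
  | const x c => simp only [writes, mem_singleton] at hi; simp [run, hi]
  | op o x y z => simp only [writes, mem_singleton] at hi; simp [run, hi]
  | emit x => rfl
  | seq p q hp hq =>
    simp only [writes, mem_union, not_or] at hi
    simp only [run]; rw [hq _ hi.2, hp _ hi.1]
  | ite x p q hp hq =>
    simp only [writes, mem_union, not_or] at hi
    simp only [run]; split_ifs
    · exact hq _ hi.2
    · exact hp _ hi.1
  | _ => rfl

lemma size_eval_le (o : Op) {a b K : ℕ} (ha : a.size ≤ K) (hb : b.size ≤ K) :
    (o.eval a b).size ≤ 2 * (K + 1) := by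
  rw [Nat.size_le] at ha hb
  have h1 : 2 ^ K ≤ 2 ^ (2 * (K + 1)) := Nat.pow_le_pow_right (by norm_num) (by omega)
  rw [Nat.size_le]
  cases o with
  | add =>
    calc a + b < 2 ^ K + 2 ^ K := by omega
      _ = 2 ^ (K + 1) := by ring
      _ ≤ _ := Nat.pow_le_pow_right (by norm_num) (by omega)
  | sub => exact (Nat.sub_le a b).trans_lt (ha.trans_le h1)
  | mul =>
    calc a * b < 2 ^ K * 2 ^ K := Nat.mul_lt_mul'' ha hb
      _ = 2 ^ (2 * K) := by ring
      _ ≤ _ := Nat.pow_le_pow_right (by norm_num) (by omega)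
  | div => exact (Nat.div_le_self a b).trans_lt (ha.trans_le h1)
  | mod => exact (Nat.mod_le a b).trans_lt (ha.trans_le h1)

/-- A loop-free program takes quadratic time and lengthens the registers by a constant factor. -/
lemma exists_exec_run (p : Prog) (hp : LoopFree p) : ∃ C : ℕ, ∀ (s : ℕ → ℕ) (K : ℕ),
    (∀ i, (s i).size ≤ K) → (∀ i, ((run p s).1 i).size ≤ C * (K + 1)) ∧
      ∃ t ≤ C * (K + 1) ^ 2, Exec p s (run p s).1 (run p s).2 t := by
  have hsq : ∀ K : ℕ, K + 1 ≤ (K + 1) ^ 2 := fun K => by nlinarith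
  induction p with
  | const x c =>
    refine ⟨1 + c.size, fun s K hs => ⟨fun i => ?_, _, ?_, Exec.const x c s⟩⟩
    · by_cases h : i = x
      · subst h; simp only [run, Function.update_self]; nlinarith
      · simp only [run, Function.update_of_ne h]; have := hs i; nlinarith
    · have := hsq K; nlinarith
  | op o x y z =>
    refine ⟨4, fun s K hs => ⟨fun i => ?_, _, ?_, Exec.op o x y z s⟩⟩
    · by_cases h : i = x
      · subst h
        simp only [run, Function.update_self]
        have := size_eval_le o (hs y) (hs z); omega
      · simp only [run, Function.update_of_ne h]; have := hs i; omega
    · have h1 := hs y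
      have h2 := hs z
      calc _ ≤ (2 * (K + 1)) ^ 2 := Nat.pow_le_pow_left (by omega) 2
        _ = _ := by ring
  | emit x =>
    refine ⟨1, fun s K hs => ⟨fun i => ?_, _, ?_, Exec.emit x s⟩⟩
    · have := hs i; simp only [run]; omega
    · have := hs x; have := hsq K; omega
  | seq p q ihp ihq =>
    obtain ⟨C₁, h₁⟩ := ihp hp.1
    obtain ⟨C₂, h₂⟩ := ihq hp.2
    -- The second program starts from registers of `C₁ (K + 1)` bits; squaring this length in its
    -- time bound gives `(C₁ + 1) ^ 2`.
    refine ⟨C₁ + C₂ * (C₁ + 1) ^ 2, fun s K hs => ?_⟩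
    obtain ⟨a₁, t₁, b₁, e₁⟩ := h₁ s K hs
    obtain ⟨a₂, t₂, b₂, e₂⟩ := h₂ _ _ a₁
    have hle : C₁ * (K + 1) + 1 ≤ (C₁ + 1) * (K + 1) := by nlinarith
    refine ⟨fun i => (a₂ i).trans ?_, t₁ + t₂, ?_, Exec.seq e₁ e₂⟩
    · calc C₂ * (C₁ * (K + 1) + 1) ≤ C₂ * ((C₁ + 1) ^ 2 * (K + 1)) := by
            refine Nat.mul_le_mul_left _ (hle.trans (Nat.mul_le_mul_right _ (hsq C₁)))
        _ ≤ _ := by rw [← mul_assoc]; exact Nat.mul_le_mul_right _ (Nat.le_add_left _ _)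
    · calc t₁ + t₂ ≤ C₁ * (K + 1) ^ 2 + C₂ * ((C₁ + 1) * (K + 1)) ^ 2 :=
            Nat.add_le_add b₁ (b₂.trans (Nat.mul_le_mul_left _ (Nat.pow_le_pow_left hle 2)))
        _ = _ := by ring
  | ite x p q ihp ihq =>
    obtain ⟨C₁, h₁⟩ := ihp hp.1
    obtain ⟨C₂, h₂⟩ := ihq hp.2
    refine ⟨1 + C₁ + C₂, fun s K hs => ?_⟩
    have hx := hs x
    have hk := hsq K
    by_cases h : s x = 0
    · obtain ⟨a, t, b, e⟩ := h₂ s K hs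
      simp only [run, h, if_true]
      refine ⟨fun i => (a i).trans (Nat.mul_le_mul_right _ (by omega)), _, ?_,
        Exec.ite_neg h e⟩
      nlinarith
    · obtain ⟨a, t, b, e⟩ := h₁ s K hs
      simp only [run, h, if_false]
      refine ⟨fun i => (a i).trans (Nat.mul_le_mul_right _ (by omega)), _, ?_,
        Exec.ite_pos h e⟩
      nlinarith
  | _ => exact hp.elim

/-- A program that only clears a scratch register. -/
def skip : Prog := .const 19 0

/-- Sequential composition of a list of programs. -/
def block : List Prog → Prog
  | [] => skip
  | p :: ps => .seq p (block ps)

lemma loopFree_block {ps : List Prog} (h : ∀ p ∈ ps, LoopFree p) : LoopFree (block ps) := by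
  induction ps with
  | nil => trivial
  | cons p ps ih => exact ⟨h p (by simp), ih fun q hq => h q (by simp [hq])⟩

lemma writes_block_subset {T : Finset ℕ} (hT : 19 ∈ T) {ps : List Prog}
    (h : ∀ p ∈ ps, writes p ⊆ T) : writes (block ps) ⊆ T := by
  induction ps with
  | nil => simpa [block, skip, writes] using hT
  | cons p ps ih =>
    exact union_subset (h p (by simp)) (ih fun q hq => h q (by simp [hq]))

/-- `P` is an invariant, in practice that the input registers are untouched, under which the output
of each piece does not depend on its predecessors. -/
lemma mem_run_block {P : (ℕ → ℕ) → Prop} {Q : Prog → Prop} {u : ℕ} {ps : List Prog}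
    (hP : ∀ p ∈ ps, ∀ s, P s → P (run p s).1)
    (hQ : ∀ p ∈ ps, ∀ s, P s → (u ∈ (run p s).2 ↔ Q p)) {s : ℕ → ℕ} (hs : P s) :
    u ∈ (run (block ps) s).2 ↔ ∃ p ∈ ps, Q p := by
  induction ps generalizing s with
  | nil => simp [block, skip, run]
  | cons p ps ih =>
    simp only [block, run, List.mem_append, List.mem_cons, exists_eq_or_imp]
    rw [hQ p (by simp) s hs, ih (fun q hq => hP q (by simp [hq])) (fun q hq => hQ q (by simp [hq]))
      (hP p (by simp) s hs)]

end LoopFree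

/-! ### The program for the expander parents -/

section Program

/-- The scratch registers. -/
def scratch : Finset ℕ := {9, 11, 12, 13, 14, 15, 16, 18, 19}

/-- Registers `9 := σ'_k (register 9)`, with the side length in register `3` and `1` in
register `10`. -/
def ggCode (k : Fin 5) : Prog :=
  block ([.op .sub 11 9 10, .op .div 12 11 3, .op .mod 13 11 3] ++
    (match k with
      | 0 => []
      | 1 => [.op .add 13 12 13, .op .mod 13 13 3]
      | 2 => [.op .add 13 12 13, .op .add 13 13 10, .op .mod 13 13 3]
      | 3 => [.op .add 12 12 13, .op .mod 12 12 3]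
      | 4 => [.op .add 12 12 13, .op .add 12 12 10, .op .mod 12 12 3]) ++
    [.op .mul 11 12 3, .op .add 11 11 13, .op .add 9 11 10])

/-- If `i ≤ q`, emit `u = (q - i) w + y` unless `u ≥ v`, where `v`, `w`, `q`, `y` are in
registers `0`, `2`, `7`, `9`. -/
def emitCode (i : ℕ) : Prog :=
  -- With truncated subtraction, `q + 1 - i` is nonzero exactly when `i ≤ q`, and `v - u` exactly
  -- when `u < v`.
  block [.const 15 i, .op .add 16 7 10, .op .sub 16 16 15, .ite 16
    (block [.op .sub 16 7 15, .op .mul 16 16 2, .op .add 16 16 9, .op .sub 18 0 16,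
      .ite 18 (.emit 16) skip]) skip]

/-- Registers `9 := σ'_l (register 9)` for a word `l`. -/
def applyCode (l : List (Fin 5)) : Prog := block (l.map ggCode)

/-- Emits the parents that come from the layer word `l`. -/
def wordCode (l : List (Fin 5)) : Prog :=
  block [.op .add 9 8 20, applyCode l, .op .add 14 2 10, .op .sub 14 14 9,
    .ite 14 (block ((List.range 10).map fun i => emitCode (i + 1))) skip]

/-- All words of length `i` over the five permutations. -/
def words : ℕ → List (List (Fin 5))
  | 0 => [[]]
  | i + 1 => (List.finRange 5).flatMap fun k => (words i).map (k :: ·)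

/-- Turns the recursive layering into a list of words of fixed length, so that it can be hard-coded
without loops. -/
lemma mem_layered_iff (i m j z : ℕ) : z ∈ getParentsLayered i m j ↔
    ∃ l ∈ words i, l.foldl (fun z k => ggMap m k z) j = z := by
  induction i generalizing j with
  | zero => simp [getParentsLayered, words, eq_comm]
  | succ i ih =>
    simp only [getParentsLayered, getParentsGG_eq, mem_biUnion, mem_image, mem_univ, true_and, ih,
      words, List.mem_flatMap, List.mem_finRange, List.mem_map]
    constructor
    · rintro ⟨_, ⟨k, rfl⟩, l, hl, rfl⟩
      exact ⟨k :: l, ⟨k, l, hl, rfl⟩, rfl⟩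
    · rintro ⟨_, ⟨k, l, hl, rfl⟩, rfl⟩
      exact ⟨_, ⟨k, rfl⟩, l, hl, rfl⟩

lemma loopFree_ggCode (k : Fin 5) : LoopFree (ggCode k) := by
  fin_cases k <;> simp [ggCode, block, LoopFree, skip]

lemma writes_ggCode (k : Fin 5) : writes (ggCode k) ⊆ scratch := by
  fin_cases k <;> decide

lemma run_ggCode (k : Fin 5) {s : ℕ → ℕ} (h10 : s 10 = 1) :
    (run (ggCode k) s).1 9 = ggMap (s 3) k (s 9) ∧ (run (ggCode k) s).2 = [] := by
  fin_cases k <;>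
    simp [ggCode, block, skip, run, Op.eval, ggMap, ggPerm, pairToInt, intToPair, h10]

lemma loopFree_applyCode (l : List (Fin 5)) : LoopFree (applyCode l) :=
  loopFree_block fun p hp => by
    obtain ⟨k, -, rfl⟩ := List.mem_map.1 hp
    exact loopFree_ggCode k

lemma writes_applyCode (l : List (Fin 5)) : writes (applyCode l) ⊆ scratch :=
  writes_block_subset (by decide) fun p hp => by
    obtain ⟨k, -, rfl⟩ := List.mem_map.1 hp
    exact writes_ggCode k

lemma run_applyCode (l : List (Fin 5)) {s : ℕ → ℕ} (h10 : s 10 = 1) :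
    (run (applyCode l) s).1 9 = l.foldl (fun z k => ggMap (s 3) k z) (s 9) ∧
      (run (applyCode l) s).2 = [] := by
  induction l generalizing s with
  | nil => simp [applyCode, block, skip, run]
  | cons k l ih =>
    obtain ⟨h1, h2⟩ := run_ggCode k h10
    have h3 : (run (ggCode k) s).1 3 = s 3 :=
      run_frame _ _ fun h => absurd (writes_ggCode k h) (by decide)
    have h4 : (run (ggCode k) s).1 10 = 1 := by
      rw [run_frame _ _ fun h => absurd (writes_ggCode k h) (by decide), h10]
    have := ih h4
    simp only [applyCode, List.map_cons, block, run, List.foldl_cons] at this ⊢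
    rw [this.1, this.2, h1, h2, h3]
    simp

lemma loopFree_emitCode (i : ℕ) : LoopFree (emitCode i) := by
  simp [emitCode, LoopFree, block, skip]

lemma writes_emitCode (i : ℕ) : writes (emitCode i) ⊆ {15, 16, 18, 19} := by
  simp only [emitCode, block, skip, writes]; decide

lemma mem_run_emitCode (i u : ℕ) {s : ℕ → ℕ} (h10 : s 10 = 1) :
    u ∈ (run (emitCode i) s).2 ↔ i ≤ s 7 ∧ (s 7 - i) * s 2 + s 9 = u ∧ u < s 0 := by
  by_cases h : i ≤ s 7
  · have : s 7 + 1 - i ≠ 0 := by omega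
    by_cases h' : (s 7 - i) * s 2 + s 9 < s 0
    · have h3 : s 0 - ((s 7 - i) * s 2 + s 9) ≠ 0 := by omega
      simp [emitCode, block, skip, run, Op.eval, h10, this, h3, h]
      constructor
      · rintro rfl; exact ⟨rfl, h'⟩
      · rintro ⟨rfl, -⟩; rfl
    · have h3 : s 0 - ((s 7 - i) * s 2 + s 9) = 0 := by omega
      simp [emitCode, block, skip, run, Op.eval, h10, this, h3, h]
      omega
  · have : s 7 + 1 - i = 0 := by omega
    simp [emitCode, block, skip, run, Op.eval, h10, this, h]

lemma loopFree_emitCodes : LoopFree (block ((List.range 10).map fun i => emitCode (i + 1))) :=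
  loopFree_block fun p hp => by
    obtain ⟨k, -, rfl⟩ := List.mem_map.1 hp
    exact loopFree_emitCode _

lemma writes_emitCodes :
    writes (block ((List.range 10).map fun i => emitCode (i + 1))) ⊆ {15, 16, 18, 19} :=
  writes_block_subset (by decide) fun p hp => by
    obtain ⟨k, -, rfl⟩ := List.mem_map.1 hp
    exact writes_emitCode _

lemma mem_run_emitCodes (u : ℕ) {s : ℕ → ℕ} (h10 : s 10 = 1) :
    u ∈ (run (block ((List.range 10).map fun i => emitCode (i + 1))) s).2 ↔
      ∃ i ∈ Icc 1 10, i ≤ s 7 ∧ (s 7 - i) * s 2 + s 9 = u ∧ u < s 0 := by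
  have h := mem_run_block (u := u) (ps := (List.range 10).map fun i => emitCode (i + 1))
    (P := fun r => ∀ i, i ∉ ({15, 16, 18, 19} : Finset ℕ) → r i = s i)
    (Q := fun p => u ∈ (run p s).2) (s := s)
    (fun p hp r hr i hi => by
      obtain ⟨k, -, rfl⟩ := List.mem_map.1 hp
      rw [run_frame _ _ fun h => hi (writes_emitCode _ h), hr i hi])
    (fun p hp r hr => by
      obtain ⟨k, -, rfl⟩ := List.mem_map.1 hp
      rw [mem_run_emitCode _ _ h10, mem_run_emitCode _ _ ((hr 10 (by decide)).trans h10),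
        hr 0 (by decide), hr 2 (by decide), hr 7 (by decide), hr 9 (by decide)])
    (fun i _ => rfl)
  rw [h]
  constructor
  · rintro ⟨p, hp, hu⟩
    obtain ⟨k, hk, rfl⟩ := List.mem_map.1 hp
    have := List.mem_range.1 hk
    exact ⟨k + 1, mem_Icc.2 ⟨by omega, by omega⟩, (mem_run_emitCode _ _ h10).1 hu⟩
  · rintro ⟨i, hi, hu⟩
    have := mem_Icc.1 hi
    refine ⟨emitCode (i - 1 + 1), List.mem_map.2 ⟨i - 1, List.mem_range.2 (by omega), rfl⟩, ?_⟩
    rw [show i - 1 + 1 = i by omega]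
    exact (mem_run_emitCode _ _ h10).2 hu

lemma loopFree_wordCode (l : List (Fin 5)) : LoopFree (wordCode l) := by
  simp [wordCode, block, LoopFree, skip, loopFree_applyCode, loopFree_emitCodes]

lemma writes_wordCode (l : List (Fin 5)) : writes (wordCode l) ⊆ scratch := by
  refine writes_block_subset (by decide) fun p hp => ?_
  simp only [List.mem_cons, List.not_mem_nil, or_false] at hp
  rcases hp with rfl | rfl | rfl | rfl | rfl
  · decide
  · exact writes_applyCode l
  · decide
  · decide
  · exact union_subset (writes_emitCodes.trans (by decide)) (by decide)

lemma mem_run_wordCode (l : List (Fin 5)) (u : ℕ) {s : ℕ → ℕ} (h10 : s 10 = 1) (h20 : s 20 = 0) :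
    u ∈ (run (wordCode l) s).2 ↔ l.foldl (fun z k => ggMap (s 3) k z) (s 8) ≤ s 2 ∧
      ∃ i ∈ Icc 1 10, i ≤ s 7 ∧
        (s 7 - i) * s 2 + l.foldl (fun z k => ggMap (s 3) k z) (s 8) = u ∧ u < s 0 := by
  set z := l.foldl (fun z k => ggMap (s 3) k z) (s 8) with hz
  set s₁ := Function.update s 9 (s 8) with hs₁
  obtain ⟨r1, r2⟩ := run_applyCode l (s := s₁) (by simp [hs₁, h10])
  set s₂ := (run (applyCode l) s₁).1 with hs₂
  have r1 : s₂ 9 = z := by rw [r1, hz, hs₁]; simp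
  have fr : ∀ i ∉ scratch, s₂ i = s i := fun i hi => by
    rw [hs₂, run_frame _ _ fun h => hi (writes_applyCode l h), hs₁, Function.update_of_ne]
    rintro rfl; exact hi (by decide)
  have f0 := fr 0 (by decide)
  have f2 := fr 2 (by decide)
  have f7 := fr 7 (by decide)
  have f10 := (fr 10 (by decide)).trans h10
  set s₃ := Function.update s₂ 14 (s 2 + 1 - z) with hs₃
  have hout : (run (wordCode l) s).2 = (if s 2 + 1 - z = 0 then [] else
      (run (block ((List.range 10).map fun i => emitCode (i + 1))) s₃).2) := by
    rw [wordCode]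
    generalize block ((List.range 10).map fun i => emitCode (i + 1)) = E
    simp [block, run, Op.eval, h20, ← hs₁, ← hs₂, r2, f2, f10, skip, r1, hs₃]
    split_ifs <;> rfl
  rw [hout]
  split_ifs with h
  · simp; omega
  · rw [mem_run_emitCodes u (by simp [hs₃, f10])]
    simp [hs₃, f0, f2, f7, r1, show z ≤ s 2 by omega]

lemma loopFree_wordCodes (L : ℕ) : LoopFree (block ((words L).map wordCode)) :=
  loopFree_block fun p hp => by
    obtain ⟨k, -, rfl⟩ := List.mem_map.1 hp
    exact loopFree_wordCode _

lemma writes_wordCodes (L : ℕ) : writes (block ((words L).map wordCode)) ⊆ scratch :=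
  writes_block_subset (by decide) fun p hp => by
    obtain ⟨k, -, rfl⟩ := List.mem_map.1 hp
    exact writes_wordCode _

lemma mem_run_wordCodes (L u : ℕ) {s : ℕ → ℕ} (h10 : s 10 = 1) (h20 : s 20 = 0) :
    u ∈ (run (block ((words L).map wordCode)) s).2 ↔
      ∃ y ∈ getParentsLayered L (s 3) (s 8), y ≤ s 2 ∧
        ∃ i ∈ Icc 1 10, i ≤ s 7 ∧ (s 7 - i) * s 2 + y = u ∧ u < s 0 := by
  have h := mem_run_block (u := u) (ps := (words L).map wordCode)
    (P := fun r => ∀ i, i ∉ scratch → r i = s i)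
    (Q := fun p => u ∈ (run p s).2) (s := s)
    (fun p hp r hr i hi => by
      obtain ⟨k, -, rfl⟩ := List.mem_map.1 hp
      rw [run_frame _ _ fun h => hi (writes_wordCode _ h), hr i hi])
    (fun p hp r hr => by
      obtain ⟨k, -, rfl⟩ := List.mem_map.1 hp
      rw [mem_run_wordCode _ _ h10 h20, mem_run_wordCode _ _ ((hr 10 (by decide)).trans h10)
        ((hr 20 (by decide)).trans h20),
        hr 0 (by decide), hr 2 (by decide), hr 3 (by decide), hr 7 (by decide), hr 8 (by decide)])
    (fun i _ => rfl)
  rw [h]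
  constructor
  · rintro ⟨p, hp, hu⟩
    obtain ⟨l, hl, rfl⟩ := List.mem_map.1 hp
    exact ⟨_, (mem_layered_iff _ _ _ _).2 ⟨l, hl, rfl⟩, (mem_run_wordCode _ _ h10 h20).1 hu⟩
  · rintro ⟨y, hy, hu⟩
    obtain ⟨l, hl, rfl⟩ := (mem_layered_iff _ _ _ _).1 hy
    exact ⟨_, List.mem_map.2 ⟨l, hl, rfl⟩, (mem_run_wordCode _ _ h10 h20).2 hu⟩

end Program

/-! ### The loop over the dyadic levels and its running time -/

section Navigation

/-- Emits `v - c - k` if positive, where `v` and `c` are in registers `0` and `5`. -/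
def nearEmitCode (k : ℕ) : Prog :=
  block [.const 15 k, .op .add 9 5 15, .op .sub 9 0 9, .ite 9 (.emit 9) skip]

/-- Emits `v - c - 1, …, v - c - 4`, as far as positive. -/
def nearCode : Prog := block ((List.range 4).map fun k => nearEmitCode (k + 1))

/-- Increases `c` by `4` and prepares the dyadic level. -/
def prepareCode : Prog :=
  block [.const 15 4, .op .add 5 5 15, .op .div 7 0 2, .op .mod 8 0 2, .op .add 8 8 10]

/-- Shifts the pair of side lengths in registers `3` and `4` by one level. -/
def sideCode : Prog :=
  block [.op .add 11 3 3, .op .sub 12 11 10, .op .mul 13 12 12, .op .add 14 2 2,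
    .op .add 14 14 14, .op .sub 14 14 13, .op .add 3 4 20,
    .ite 14 (.op .add 4 11 20) (.op .add 4 12 20)]

/-- Doubles `w`, updates the loop flag, and clears the scratch registers. -/
def updateCode : Prog :=
  block [.op .add 2 2 2, .op .add 6 1 10, .op .sub 6 6 2, .const 7 0, .const 8 0, .const 9 0,
    .const 11 0, .const 12 0, .const 13 0, .const 14 0, .const 15 0, .const 16 0, .const 18 0]

/-- One dyadic level. -/
def levelCode (L : ℕ) : Prog :=
  .seq nearCode (.seq prepareCode (.seq (block ((words L).map wordCode))
    (.seq sideCode updateCode)))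

def initCode : Prog :=
  block [.const 10 1, .const 2 2, .const 3 2, .const 4 2, .op .add 6 1 10, .op .sub 6 6 2]

/-- The registers before level `t`. -/
noncomputable def levelState (v N t : ℕ) : ℕ → ℕ
  | 0 => v
  | 1 => N
  | 2 => 2 ^ t
  | 3 => sideLen (2 ^ t)
  | 4 => sideLen (2 ^ (t + 1))
  | 5 => 4 * (t - 1)
  | 6 => N + 1 - 2 ^ t
  | 10 => 1
  | _ => 0

/-- From `(s - 1)² < N ≤ s²` follows `(2 s - 2)² < 4 N ≤ (2 s)²`, leaving two candidates that one
squaring separates. Keeping the sides of two consecutive levels thus avoids square roots. -/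
lemma sideLen_four_mul {N : ℕ} (hN : 0 < N) : sideLen (4 * N) =
    if 4 * N - (2 * sideLen N - 1) * (2 * sideLen N - 1) = 0 then 2 * sideLen N - 1
    else 2 * sideLen N := by
  obtain ⟨h0, h1⟩ := sideLen_spec N
  obtain ⟨s, hs⟩ : ∃ s, sideLen N = s + 1 := ⟨sideLen N - 1, by omega⟩
  have h2 : s ^ 2 < N := by
    rcases Nat.eq_zero_or_pos s with rfl | hs0
    · simpa using hN
    · by_contra! hle
      have := sideLen_le hs0 hle
      omega
  rw [hs] at h1 ⊢
  have e : 2 * (s + 1) - 1 = 2 * s + 1 := by omega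
  rw [e]
  split_ifs with h
  · exact sideLen_eq (by nlinarith [Nat.sub_eq_zero_iff_le.1 h]) (by nlinarith)
  · rw [show 2 * (s + 1) = 2 * s + 1 + 1 by ring]
    refine sideLen_eq (by nlinarith) ?_
    rw [Nat.sub_eq_zero_iff_le] at h
    nlinarith

lemma sideLen_le_self {N : ℕ} (hN : 0 < N) : sideLen N ≤ N := sideLen_le hN (by nlinarith)

lemma run_initCode (v N : ℕ) :
    (run initCode (input v N)).1 = levelState v N 1 ∧ (run initCode (input v N)).2 = [] := by
  have h2 : sideLen 2 = 2 := sideLen_eq (m := 1) (by norm_num) (by norm_num)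
  have h4 : sideLen 4 = 2 := sideLen_eq (m := 1) (by norm_num) (by norm_num)
  refine ⟨?_, by simp [initCode, block, skip, run]⟩
  funext i
  by_cases hi : i ≤ 20
  · interval_cases i <;> simp [initCode, block, skip, run, input, levelState, Op.eval, h2, h4]
  · have hw : i ∉ writes initCode := by
      simp only [initCode, block, skip, writes, mem_union, mem_singleton, not_or]; omega
    rw [run_frame _ _ hw, levelState]
    · simp only [input]; split_ifs <;> omega
    all_goals rintro rfl; omega

/-- The output of level `t`. -/
def LevelOut (L v t u : ℕ) : Prop :=
  (u ≠ 0 ∧ ∃ k ∈ Icc 1 4, u = v - (4 * (t - 1) + k)) ∨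
    ∃ y ∈ getParentsLayered L (sideLen (2 ^ t)) (v % 2 ^ t + 1), y ≤ 2 ^ t ∧
      ∃ i ∈ Icc 1 10, i ≤ v / 2 ^ t ∧ (v / 2 ^ t - i) * 2 ^ t + y = u ∧ u < v

lemma levelState_of_lt (v N t : ℕ) {i : ℕ} (hi : 10 < i) : levelState v N t i = 0 := by
  rw [levelState] <;> rintro rfl <;> omega

lemma writes_nearEmitCode (k : ℕ) : writes (nearEmitCode k) ⊆ {9, 15, 19} := by
  simp only [nearEmitCode, block, skip, writes]; decide

lemma mem_run_nearEmitCode (k u : ℕ) (s : ℕ → ℕ) :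
    u ∈ (run (nearEmitCode k) s).2 ↔ u ≠ 0 ∧ u = s 0 - (s 5 + k) := by
  simp only [nearEmitCode, block, skip, run]
  split_ifs with h <;> simp_all [Op.eval]

lemma loopFree_nearCode : LoopFree nearCode :=
  loopFree_block fun p hp => by
    obtain ⟨k, -, rfl⟩ := List.mem_map.1 hp
    simp [nearEmitCode, block, skip, LoopFree]

lemma writes_nearCode : writes nearCode ⊆ {9, 15, 19} :=
  writes_block_subset (by decide) fun p hp => by
    obtain ⟨k, -, rfl⟩ := List.mem_map.1 hp
    exact writes_nearEmitCode _

lemma mem_run_nearCode (u : ℕ) (s : ℕ → ℕ) :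
    u ∈ (run nearCode s).2 ↔ u ≠ 0 ∧ ∃ k ∈ Icc 1 4, u = s 0 - (s 5 + k) := by
  have h := mem_run_block (u := u) (ps := (List.range 4).map fun k => nearEmitCode (k + 1))
    (P := fun r => ∀ i, i ∉ ({9, 15, 19} : Finset ℕ) → r i = s i)
    (Q := fun p => u ∈ (run p s).2) (s := s)
    (fun p hp r hr i hi => by
      obtain ⟨k, -, rfl⟩ := List.mem_map.1 hp
      rw [run_frame _ _ fun h => hi (writes_nearEmitCode _ h), hr i hi])
    (fun p hp r hr => by
      obtain ⟨k, -, rfl⟩ := List.mem_map.1 hp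
      rw [mem_run_nearEmitCode, mem_run_nearEmitCode, hr 0 (by decide), hr 5 (by decide)])
    (fun i _ => rfl)
  rw [nearCode, h]
  constructor
  · rintro ⟨p, hp, hu⟩
    obtain ⟨k, hk, rfl⟩ := List.mem_map.1 hp
    have := List.mem_range.1 hk
    obtain ⟨h1, h2⟩ := (mem_run_nearEmitCode _ _ _).1 hu
    exact ⟨h1, k + 1, mem_Icc.2 ⟨by omega, by omega⟩, h2⟩
  · rintro ⟨h0, i, hi, hu⟩
    have := mem_Icc.1 hi
    refine ⟨nearEmitCode (i - 1 + 1), List.mem_map.2 ⟨i - 1, List.mem_range.2 (by omega), rfl⟩, ?_⟩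
    rw [show i - 1 + 1 = i by omega]
    exact (mem_run_nearEmitCode _ _ _).2 ⟨h0, hu⟩

lemma run_sideCode {w : ℕ} (hw : 0 < w) {s : ℕ → ℕ} (h2 : s 2 = w) (h3 : s 3 = sideLen w)
    (h10 : s 10 = 1) (h20 : s 20 = 0) :
    (run sideCode s).1 3 = s 4 ∧ (run sideCode s).1 4 = sideLen (4 * w) ∧
      (run sideCode s).2 = [] := by
  rw [sideLen_four_mul hw, show 4 * w = w + w + (w + w) by ring, two_mul]
  generalize sideLen w = a at h3 ⊢
  generalize hc : w + w + (w + w) - (a + a - 1) * (a + a - 1) = c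
  by_cases h : c = 0 <;>
    simp [sideCode, block, skip, run, Op.eval, h2, h3, h10, h20, hc, h]

lemma run_updateCode (v N t : ℕ) {s : ℕ → ℕ} (h0 : s 0 = v) (h1 : s 1 = N)
    (h2 : s 2 = 2 ^ t) (h3 : s 3 = sideLen (2 ^ (t + 1))) (h4 : s 4 = sideLen (2 ^ (t + 2)))
    (h5 : s 5 = 4 * t) (h10 : s 10 = 1) (h17 : s 17 = 0) (h20 : s 20 = 0)
    (hs : ∀ i, 20 < i → s i = 0) :
    (run updateCode s).1 = levelState v N (t + 1) ∧ (run updateCode s).2 = [] := by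
  have hw2 : 2 ^ t + 2 ^ t = 2 ^ (t + 1) := by ring
  refine ⟨?_, by simp [updateCode, block, skip, run]⟩
  funext i
  by_cases hi : i ≤ 20
  · interval_cases i <;>
      simp [updateCode, block, skip, run, Op.eval, levelState, h0, h1, h2, h3, h4, h5, h10, h17,
        h20, hw2]
  · have hw : i ∉ writes updateCode := by
      simp only [updateCode, block, skip, writes, mem_union, mem_singleton, not_or]; omega
    rw [run_frame _ _ hw, levelState_of_lt _ _ _ (by omega), hs i (by omega)]

lemma loopFree_levelCode (L : ℕ) : LoopFree (levelCode L) :=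
  ⟨loopFree_nearCode, by simp [prepareCode, block, skip, LoopFree], loopFree_wordCodes L,
    by simp [sideCode, block, skip, LoopFree], by simp [updateCode, block, skip, LoopFree]⟩

lemma run_levelCode (L v N t : ℕ) (ht : 1 ≤ t) :
    (run (levelCode L) (levelState v N t)).1 = levelState v N (t + 1) ∧
      ∀ u, u ∈ (run (levelCode L) (levelState v N t)).2 ↔ LevelOut L v t u := by
  set s₀ := (run nearCode (levelState v N t)).1 with hs₀
  have fr₀ : ∀ i ∉ ({9, 15, 19} : Finset ℕ), s₀ i = levelState v N t i := fun i hi =>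
    run_frame _ _ fun h => hi (writes_nearCode h)
  set s₁ := (run prepareCode s₀).1 with hs₁
  have fr₁ : ∀ i ∉ ({5, 7, 8, 15, 19} : Finset ℕ), s₁ i = s₀ i := fun i hi =>
    run_frame _ _ fun h => hi ((by decide : writes prepareCode ⊆ {5, 7, 8, 15, 19}) h)
  have a0 : s₁ 0 = v := (fr₁ 0 (by decide)).trans (fr₀ 0 (by decide))
  have a1 : s₁ 1 = N := (fr₁ 1 (by decide)).trans (fr₀ 1 (by decide))
  have a2 : s₁ 2 = 2 ^ t := (fr₁ 2 (by decide)).trans (fr₀ 2 (by decide))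
  have a3 : s₁ 3 = sideLen (2 ^ t) := (fr₁ 3 (by decide)).trans (fr₀ 3 (by decide))
  have a4 : s₁ 4 = sideLen (2 ^ (t + 1)) := (fr₁ 4 (by decide)).trans (fr₀ 4 (by decide))
  have a10 : s₁ 10 = 1 := (fr₁ 10 (by decide)).trans (fr₀ 10 (by decide))
  have a17 : s₁ 17 = 0 := (fr₁ 17 (by decide)).trans (fr₀ 17 (by decide))
  have a20 : s₁ 20 = 0 := (fr₁ 20 (by decide)).trans (fr₀ 20 (by decide))
  have b0 : s₀ 0 = v := fr₀ 0 (by decide)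
  have b2 : s₀ 2 = 2 ^ t := fr₀ 2 (by decide)
  have b5 : s₀ 5 = 4 * (t - 1) := fr₀ 5 (by decide)
  have b10 : s₀ 10 = 1 := fr₀ 10 (by decide)
  have a5 : s₁ 5 = 4 * t := by
    have : s₁ 5 = s₀ 5 + 4 := by simp [hs₁, prepareCode, block, skip, run, Op.eval]
    omega
  have a7 : s₁ 7 = v / 2 ^ t := by
    simp [hs₁, prepareCode, block, skip, run, Op.eval, b0, b2]
  have a8 : s₁ 8 = v % 2 ^ t + 1 := by
    simp [hs₁, prepareCode, block, skip, run, Op.eval, b0, b2, b10]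
  have o1 : (run prepareCode s₀).2 = [] := by simp [prepareCode, block, skip, run]
  set s₂ := (run (block ((words L).map wordCode)) s₁).1 with hs₂
  have fr : ∀ i ∉ scratch, s₂ i = s₁ i := fun i hi =>
    run_frame _ _ fun h => hi (writes_wordCodes L h)
  have c4 : s₂ 4 = sideLen (2 ^ (t + 1)) := (fr 4 (by decide)).trans a4
  obtain ⟨d3, d4, o3⟩ := run_sideCode (by positivity) ((fr 2 (by decide)).trans a2)
    ((fr 3 (by decide)).trans a3) ((fr 10 (by decide)).trans a10) ((fr 20 (by decide)).trans a20)
  set s₃ := (run sideCode s₂).1 with hs₃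
  have fr₃ : ∀ i ∉ scratch ∪ {3, 4}, s₃ i = s₁ i := fun i hi => by
    have h : i ∉ writes sideCode := fun h =>
      hi ((by decide : writes sideCode ⊆ scratch ∪ {3, 4}) h)
    rw [hs₃, run_frame _ _ h, fr i fun h => hi (mem_union_left _ h)]
  have hz : ∀ i, 20 < i → s₃ i = 0 := fun i hi => by
    rw [fr₃ i (by simp only [scratch, mem_union, mem_insert, mem_singleton]; omega),
      fr₁ i (by simp only [mem_insert, mem_singleton]; omega),
      fr₀ i (by simp only [mem_insert, mem_singleton]; omega), levelState_of_lt _ _ _ (by omega)]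
  obtain ⟨e1, e2⟩ := run_updateCode v N t (s := s₃)
    ((fr₃ 0 (by decide)).trans a0) ((fr₃ 1 (by decide)).trans a1) ((fr₃ 2 (by decide)).trans a2)
    (d3.trans c4) (d4.trans (by rw [show 4 * 2 ^ t = 2 ^ (t + 2) by ring]))
    ((fr₃ 5 (by decide)).trans a5) ((fr₃ 10 (by decide)).trans a10)
    ((fr₃ 17 (by decide)).trans a17) ((fr₃ 20 (by decide)).trans a20) hz
  refine ⟨e1, fun u => ?_⟩
  simp only [levelCode, run, ← hs₀, ← hs₁, ← hs₂, ← hs₃, o1, o3, e2, List.append_nil,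
    List.nil_append, List.mem_append]
  rw [mem_run_nearCode, mem_run_wordCodes L u a10 a20, a0, a2, a3, a7, a8, LevelOut]
  rfl

/-- Every round starts from such a state, so the constant-factor growth of bit lengths in
`exists_exec_run` does not compound over the rounds. -/
lemma size_levelState_le {v n t : ℕ} (hv : v ≤ 2 ^ n) (ht : t ≤ n + 1) (i : ℕ) :
    (levelState v (2 ^ n) t i).size ≤ n + 3 := by
  rw [Nat.size_le]
  have p1 : 2 ^ (n + 3) = 8 * 2 ^ n := by ring
  have p2 : 2 ^ t ≤ 2 * 2 ^ n := by
    calc 2 ^ t ≤ 2 ^ (n + 1) := Nat.pow_le_pow_right (by norm_num) ht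
      _ = _ := by ring
  have p3 : sideLen (2 ^ t) ≤ 2 ^ t := sideLen_le_self (by positivity)
  have p4 : sideLen (2 ^ (t + 1)) ≤ 2 * 2 ^ t :=
    (sideLen_le_self (by positivity)).trans (by rw [pow_succ]; omega)
  have p5 : n < 2 ^ n := Nat.lt_two_pow_self
  unfold levelState
  split <;> omega

/-- Induction on the number `k` of remaining levels: the flag `2 ^ n + 1 - 2 ^ t` vanishes first at
`t = n + 1`. -/
lemma exists_exec_loop (L : ℕ) : ∃ C : ℕ, ∀ (n v : ℕ), v ≤ 2 ^ n → ∀ k ≤ n,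
    ∃ (out : List ℕ) (T : ℕ), Exec (.while 6 (levelCode L)) (levelState v (2 ^ n) (n + 1 - k))
      (levelState v (2 ^ n) (n + 1)) out T ∧
      (∀ u, u ∈ out ↔ ∃ t ∈ Icc (n + 1 - k) n, LevelOut L v t u) ∧
      T ≤ (k + 1) * (C * (n + 4) ^ 2) := by
  obtain ⟨C, hC⟩ := exists_exec_run (levelCode L) (loopFree_levelCode L)
  refine ⟨C + 1, fun n v hv k => ?_⟩
  have hsq : n + 4 ≤ (n + 4) ^ 2 := by nlinarith
  induction k with
  | zero =>
    intro _
    have h6 : levelState v (2 ^ n) (n + 1) 6 = 0 := by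
      have : 2 ^ (n + 1) = 2 * 2 ^ n := by ring
      have : 0 < 2 ^ n := by positivity
      simp only [levelState]; omega
    refine ⟨[], _, Exec.while_done h6, fun u => by simp, ?_⟩
    have := size_levelState_le (t := n + 1 - 0) hv le_rfl 6
    have e : (0 + 1) * ((C + 1) * (n + 4) ^ 2) = C * (n + 4) ^ 2 + (n + 4) ^ 2 := by ring
    omega
  | succ k ih =>
    intro hk
    obtain ⟨out, T, he, ho, hT⟩ := ih (by omega)
    set t := n + 1 - (k + 1) with ht
    have ht1 : n + 1 - k = t + 1 := by omega
    rw [ht1] at he ho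
    have h6 : levelState v (2 ^ n) t 6 ≠ 0 := by
      have : 2 ^ t ≤ 2 ^ n := Nat.pow_le_pow_right (by norm_num) (by omega)
      simp only [levelState]; omega
    obtain ⟨r1, r2⟩ := run_levelCode L v (2 ^ n) t (by omega)
    obtain ⟨-, T', hT', he'⟩ := hC (levelState v (2 ^ n) t) (n + 3)
      (size_levelState_le hv (by omega))
    rw [r1] at he'
    refine ⟨_, _, Exec.while_step h6 he' he, fun u => ?_, ?_⟩
    · rw [List.mem_append, r2, ho]
      constructor
      · rintro (h | ⟨t', ht', h⟩)
        · exact ⟨t, mem_Icc.2 ⟨le_rfl, by omega⟩, h⟩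
        · have := mem_Icc.1 ht'
          exact ⟨t', mem_Icc.2 ⟨by omega, by omega⟩, h⟩
      · rintro ⟨t', ht', h⟩
        have := mem_Icc.1 ht'
        rcases this.1.eq_or_lt with h' | h'
        · rw [← h'] at h; exact Or.inl h
        · exact Or.inr ⟨t', mem_Icc.2 ⟨by omega, by omega⟩, h⟩
    · have := size_levelState_le (t := t) hv (by omega) 6
      nlinarith

/-- The `n` levels emit four near parents each, which exhausts the distances up to `4 n`. Running
`t` up to `n` instead of `Nat.clog 2 v` adds nothing, since any level with an admissible `i` has `2
^ t ≤ v`; testing `u < v` replaces `u ≠ v` because edges go upwards. -/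
lemma exists_levelOut_iff {δ : ℝ} {n v u : ℕ} (hv : v ∈ Icc 1 (2 ^ n)) :
    (∃ t ∈ Icc 1 n, LevelOut (numLayers (δ / 5 / 2)) v t u) ↔
      u ∈ Icc 1 (2 ^ n) ∧ Edge δ n u v := by
  have hv' := mem_Icc.1 hv
  constructor
  · rintro ⟨t, ht, ⟨hu, k, hk, rfl⟩ | ⟨y, hy, hyt, i, hi, hiv, rfl, hlt⟩⟩
    · have := mem_Icc.1 ht
      have := mem_Icc.1 hk
      have hm : v - (4 * (t - 1) + k) ∈ Icc 1 (2 ^ n) := mem_Icc.2 ⟨by omega, by omega⟩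
      exact ⟨hm, edge_of_near hm (by omega) (by omega)⟩
    · have ht := mem_Icc.1 ht
      have hi := mem_Icc.1 hi
      obtain ⟨hs0, hs⟩ := sideLen_spec (2 ^ t)
      have : NeZero (sideLen (2 ^ t)) := ⟨by omega⟩
      have hmod := Nat.mod_lt v (by positivity : 0 < 2 ^ t)
      have hy1 := (mem_Icc.1 (layered_mem _ (mem_Icc.2 ⟨by omega, by omega⟩) hy)).1
      have hm : (v / 2 ^ t - i) * 2 ^ t + y ∈ Icc 1 (2 ^ n) := mem_Icc.2 ⟨by omega, by omega⟩
      refine ⟨hm, edge_of_far (a := v / 2 ^ t - i) ht.1 hm hlt.ne hi.1 hi.2 (by omega)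
        (Nat.le_add_right _ _) ?_⟩
      rw [Nat.add_sub_cancel_left]
      exact mem_inter.2 ⟨mem_Icc.2 ⟨hy1, hyt⟩, hy⟩
  · rintro ⟨hu, he⟩
    have hlt := edge_lt he
    have hu1 := mem_Icc.1 hu
    rcases mem_union.1 (mem_inter.1 he.1).1 with h | h
    · have := mem_Ico.1 h
      -- Division of `v - u - 1` by `4` yields the level and the position with `v - u = 4 (t - 1) +
      -- k`.
      refine ⟨(v - u - 1) / 4 + 1, mem_Icc.2 ⟨by omega, by omega⟩, Or.inl ⟨by omega,
        (v - u - 1) % 4 + 1, mem_Icc.2 ⟨by omega, by omega⟩, by omega⟩⟩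
    · obtain ⟨t, ht, h⟩ := mem_biUnion.1 h
      obtain ⟨y, hy, h⟩ := mem_biUnion.1 h
      obtain ⟨i, hi, rfl⟩ := mem_image.1 h
      have ht := mem_Icc.1 ht
      have hi := mem_Icc.1 hi
      have htn : Nat.clog 2 v ≤ n := Nat.clog_le_of_le_pow hv'.2
      obtain ⟨hy1, hy2⟩ := mem_inter.1 hy
      exact ⟨t, mem_Icc.2 ⟨ht.1, by omega⟩, Or.inr ⟨y, hy2, (mem_Icc.1 hy1).2, i,
        mem_Icc.2 ⟨hi.1, by omega⟩, by omega, rfl, hlt⟩⟩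

theorem locallyNavigable_egsGraph (δ : ℝ) : LocallyNavigable (egsGraph δ) := by
  set L := numLayers (δ / 5 / 2) with hL
  obtain ⟨C, hC⟩ := exists_exec_loop L
  obtain ⟨C₀, hC₀⟩ := exists_exec_run initCode (by simp [initCode, block, skip, LoopFree])
  refine ⟨.seq initCode (.while 6 (levelCode L)), 25 * C₀ + 50 * C, 3, fun n hn v => ?_⟩
  have hv := mem_Icc.1 v.2
  obtain ⟨out, T, he, ho, hT⟩ := hC n v hv.2 n le_rfl
  rw [Nat.add_sub_cancel_left] at he ho
  obtain ⟨-, T₀, hT₀, he₀⟩ := hC₀ (input v (2 ^ n)) (n + 3) (fun i => by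
    have p1 : 2 ^ (n + 3) = 8 * 2 ^ n := by ring
    rw [Nat.size_le, input]
    split_ifs <;> omega)
  obtain ⟨r1, r2⟩ := run_initCode v (2 ^ n)
  rw [r1, r2] at he₀
  refine ⟨_, _, _, Exec.seq he₀ he, fun u => ?_, ?_⟩
  · rw [List.nil_append, ho, exists_levelOut_iff v.2]
    constructor
    · rintro ⟨h, h'⟩
      exact ⟨h, (egsGraph_adj_iff _ _).2 h'⟩
    · rintro ⟨h, h'⟩
      exact ⟨h, (egsGraph_adj_iff _ _).1 h'⟩
  -- Since `n ≥ 1`, `n + 4 ≤ 5 n` and `n + 1 ≤ 2 n`, whence the constants `25` and `50`.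
  · have h5 : (n + 4) ^ 2 ≤ 25 * n ^ 2 := by
      calc (n + 4) ^ 2 ≤ (5 * n) ^ 2 := Nat.pow_le_pow_left (by omega) 2
        _ = _ := by ring
    have h3 : n ^ 2 ≤ n ^ 3 := Nat.pow_le_pow_right hn (by norm_num)
    calc T₀ + T ≤ C₀ * (n + 4) ^ 2 + (n + 1) * (C * (n + 4) ^ 2) := Nat.add_le_add hT₀ hT
      _ ≤ C₀ * (25 * n ^ 3) + (2 * n) * (C * (25 * n ^ 2)) := by
          gcongr
          · omega
          · omega
      _ = _ := by ring

end Navigation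

end ExtremeDR

theorem mainTheorem1 (ε : ℝ) (hε : 0 < ε) :
    (∃! δ : ℝ, ExtremeDR.IsDelta ε δ) ∧
    ∀ δ : ℝ, ExtremeDR.IsDelta ε δ →
      (∀ n : ℕ, 1 ≤ n → ExtremeDR.ExtremeDepthRobust ε (ExtremeDR.egsGraph δ n)) ∧
      (∃ C : ℕ, ∀ n : ℕ, 1 ≤ n → ExtremeDR.indeg (ExtremeDR.egsGraph δ n) ≤ C * n) ∧
      ExtremeDR.LocallyNavigable (ExtremeDR.egsGraph δ) :=
  ⟨⟨_, (ExtremeDR.isDelta_iff hε).2 rfl, fun _ h => (ExtremeDR.isDelta_iff hε).1 h⟩,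
    fun δ hδ => ⟨fun _ hn => ExtremeDR.extremeDepthRobust_egsGraph hε hδ hn,
      ⟨_, fun n _ => ExtremeDR.indeg_egsGraph_le δ n⟩,
      ExtremeDR.locallyNavigable_egsGraph δ⟩⟩
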